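/- Let $N\ge 2$ be an integer, let $\mathbb{T}$ be the unit circle with normalized Haar measure $\mu$, and identify a function on $\mathbb{T}$ with a $2\pi$-periodic function of $\omega\in\mathbb{R}$ through $z=e^{-i\omega}$. For $\psi\in L^2(\mathbb{R})$ let $\widehat\psi$ be its Fourier transform, $\widehat\psi(\omega)=\int_{\mathbb{R}}\psi(t)e^{-i\omega t}\,dt$ (in the $L^2$ sense), let $U\psi(x)=N^{-1/2}\psi(x/N)$, and for $g\in L^\infty(\mathbb{T})$ let $\pi(g)\psi\in L^2(\mathbb{R})$ be given by $\widehat{\pi(g)\psi}=g\,\widehat\psi$. For $F\in L^1(\mathbb{R})$ put $\operatorname{Per}(F)(\omega)=\sum_{k\in\mathbb{Z}}F(\omega+2k\pi)$. For $m_0,m_0'\in L^\infty(\mathbb{T})$ and $g\in L^1(\mathbb{T})$ put $$R_{m_0,m_0'}g(z)=\frac1N\sum_{w^N=z}\overline{m_0(w)}\,m_0'(w)\,g(w),\qquad z\in\mathbb{T}.$$ Suppose that $(U,\pi,L^2(\mathbb{R}),\varphi,m_0)$ and $(U,\pi,L^2(\mathbb{R}),\varphi',m_0')$ are wavelet representations,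 that is, $\varphi,\varphi'\in L^2(\mathbb{R})$, $m_0,m_0'\in L^\infty(\mathbb{T})$, $U\varphi=\pi(m_0)\varphi$ and $U\varphi'=\pi(m_0')\varphi'$. Let $h=\operatorname{Per}(|\widehat\varphi|^2)$ and $h'=\operatorname{Per}(|\widehat{\varphi'}|^2)$. Then each $h_0\in L^1(\mathbb{T})$ with $R_{m_0,m_0'}h_0=h_0$ and $|h_0|^2\le c\,h\,h'$ a.e. for some constant $c>0$ has the form $$h_0=\operatorname{Per}\left(f\,\overline{\widehat\varphi}\,\widehat{\varphi'}\right)\quad\text{a.e.}$$ for some $f\in L^\infty(\mathbb{R})$ with $f(Nx)=f(x)$ for a.e. $x\in\mathbb{R}$. Conversely, for any such $f$, the function $h_0=\operatorname{Per}(f\,\overline{\widehat\varphi}\,\widehat{\varphi'})$ belongs to $L^1(\mathbb{T})$, satisfies $R_{m_0,m_0'}h_0=h_0$, and $|h_0|^2\le c\,h\,h'$ a.e. for some $c>0$. -/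

import Mathlib

open MeasureTheory
open scoped ENNReal FourierTransform ComplexConjugate

noncomputable section

namespace Wavelet

/-- The circle group `𝕋`. The class of the real number `ω` modulo `2π` stands for the point
`z = e^{-iω}` of the unit circle, so that `z ^ N` is written `N • z`, and a function on `𝕋` is a
`2π`-periodic function of `ω`. -/
abbrev Torus : Type := AddCircle (2 * Real.pi)

instance two_pi_fact : Fact (0 < 2 * Real.pi) := ⟨Real.two_pi_pos⟩

/-- The normalized Haar measure of `𝕋`. -/
abbrev μT : Measure Torus := AddCircle.haarAddCircle

/-- `L²(ℝ)`. -/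
abbrev L2R : Type := Lp ℂ 2 (volume : Measure ℝ)

/-- `L^∞(ℝ)`. -/
abbrev LinfR : Type := Lp ℂ ∞ (volume : Measure ℝ)

/-- `L^∞(𝕋)`. -/
abbrev LinfT : Type := Lp ℂ ∞ μT

/-- The Fourier transform `ψ̂(ω) = ∫ ψ(t) e^{-iωt} dt` of `ψ ∈ L²(ℝ)`. Mathlib's `𝓕` has the kernel
`e^{-2πiξt}`, whence the substitution `ξ = ω / 2π`. -/
def hat (ψ : L2R) (ω : ℝ) : ℂ := (𝓕 ψ : L2R) (ω / (2 * Real.pi))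

theorem qmp_mul (a : ℝ) (ha : a ≠ 0) :
    Measure.QuasiMeasurePreserving (fun x : ℝ => a * x) volume volume :=
  Measure.quasiMeasurePreserving_smul volume ha

theorem qmp_mk :
    Measure.QuasiMeasurePreserving (fun x : ℝ => (x : Torus)) volume μT := by
  refine ⟨AddCircle.measurable_mk', ?_⟩
  refine Measure.AbsolutelyContinuous.mk fun s hs h0 => ?_
  rw [Measure.map_apply AddCircle.measurable_mk' hs]
  have hv : (volume : Measure Torus) s = 0 := by
    rw [AddCircle.volume_eq_smul_haarAddCircle]
    simp [h0]
  have hcov : (Set.univ : Set ℝ) ⊆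
      ⋃ n : ℤ, Set.Ioc (0 + n • (2 * Real.pi)) (0 + (n + 1) • (2 * Real.pi)) :=
    (iUnion_Ioc_add_zsmul (by positivity) 0).ge
  refine measure_mono_null (t := ⋃ n : ℤ, ((fun x : ℝ => (x : Torus)) ⁻¹' s) ∩
    Set.Ioc (0 + n • (2 * Real.pi)) (0 + (n + 1) • (2 * Real.pi))) ?_ ?_
  · intro x hx
    obtain ⟨n, hn⟩ := Set.mem_iUnion.1 (hcov (Set.mem_univ x))
    exact Set.mem_iUnion.2 ⟨n, hx, hn⟩
  · refine measure_iUnion_null fun n => ?_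
    have := AddCircle.measurePreserving_mk (2 * Real.pi) (0 + n • (2 * Real.pi))
    have h2 := this.measure_preimage hs.nullMeasurableSet
    rw [hv, Measure.restrict_apply (AddCircle.measurable_mk' hs)] at h2
    rw [add_smul, one_smul, ← add_assoc]
    exact h2

theorem qmp_two_pi_mk :
    Measure.QuasiMeasurePreserving (fun ξ : ℝ => ((2 * Real.pi * ξ : ℝ) : Torus)) volume μT :=
  qmp_mk.comp (qmp_mul (2 * Real.pi) (by positivity))

theorem memLp_dilate (N : ℕ) (ψ : L2R) :
    MemLp (fun x : ℝ => ((Real.sqrt N)⁻¹ : ℂ) * ψ (x / N)) 2 volume := by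
  rcases Nat.eq_zero_or_pos N with rfl | hN
  · simp
  · refine MemLp.const_mul ?_ _
    have ha : (N : ℝ)⁻¹ ≠ 0 := by positivity
    have hm : MemLp ψ 2 (Measure.map (fun x : ℝ => (N : ℝ)⁻¹ * x) volume) := by
      rw [Real.map_volume_mul_left ha]
      exact (Lp.memLp ψ).smul_measure ENNReal.ofReal_ne_top
    have := hm.comp_of_map (by fun_prop)
    simpa [Function.comp_def, div_eq_inv_mul] using this

/-- The unitary operator `(U ψ)(x) = N^{-1/2} ψ(x / N)` on `L²(ℝ)` (for `N ≥ 1`). -/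
def U (N : ℕ) (ψ : L2R) : L2R := (memLp_dilate N ψ).toLp _

theorem memLp_mult (f : LinfT) (ψ : L2R) :
    MemLp (fun ξ : ℝ => f ((2 * Real.pi * ξ : ℝ) : Torus) * (𝓕 ψ : L2R) ξ) 2 volume := by
  refine (Lp.memLp (𝓕 ψ : L2R)).mul (p := ∞) (q := 2) ⟨?_, ?_⟩
  · exact (Lp.memLp f).1.comp_quasiMeasurePreserving qmp_two_pi_mk
  · have hb : ∀ᵐ z ∂μT, ‖f z‖ ≤ ‖f‖ := by
      filter_upwards [ae_le_eLpNormEssSup (f := f) (μ := μT)] with z hz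
      rw [Lp.norm_def, eLpNorm_exponent_top]
      exact (toReal_enorm (f z)).symm.trans_le
        (ENNReal.toReal_mono (by simpa using (Lp.memLp f).2.ne) hz)
    have := qmp_two_pi_mk.ae hb
    exact (memLp_top_of_bound
      ((Lp.memLp f).1.comp_quasiMeasurePreserving qmp_two_pi_mk) ‖f‖ this).2

/-- The representation `π` of `L^∞(𝕋)` on `L²(ℝ)`: `π(f) ψ` is the element of `L²(ℝ)` whose Fourier
transform is `f ψ̂` (see `hat_rep`). -/
def rep (f : LinfT) (ψ : L2R) : L2R := 𝓕⁻ ((memLp_mult f ψ).toLp _)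

theorem hat_rep (f : LinfT) (ψ : L2R) :
    ∀ᵐ ω : ℝ, hat (rep f ψ) ω = f (ω : Torus) * hat ψ ω := by
  have h := (memLp_mult f ψ).coeFn_toLp
  have hq := qmp_mul (2 * Real.pi)⁻¹ (by positivity)
  filter_upwards [hq.ae h] with ω hω
  have hc : 2 * Real.pi * ((2 * Real.pi)⁻¹ * ω) = ω := by field_simp
  rw [hc] at hω
  rw [hat, hat, rep, FourierTransform.fourier_fourierInv_eq, div_eq_inv_mul, hω]

/-- `(U, π, L²(ℝ), φ, m₀)` is the wavelet representation with scaling function `φ ∈ L²(ℝ)` and filter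
`m₀ ∈ L^∞(𝕋)`: the scaling equation `U φ = π(m₀) φ` holds. -/
def IsWaveletRep (N : ℕ) (φ : L2R) (m₀ : LinfT) : Prop := U N φ = rep m₀ φ

theorem per_periodic {E : Type*} [NormedAddCommGroup E] (F : ℝ → E) :
    Function.Periodic (fun ω : ℝ => ∑' k : ℤ, F (ω + 2 * k * Real.pi)) (2 * Real.pi) := by
  intro ω
  refine (Equiv.tsum_eq (Equiv.addRight (1 : ℤ))
    (fun k : ℤ => F (ω + 2 * k * Real.pi))).symm.trans ?_ |>.symm
  refine tsum_congr fun k => ?_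
  simp only [Equiv.coe_addRight, Int.cast_add, Int.cast_one]
  congr 1
  ring

/-- The periodization `Per(F)(ω) = ∑_{k ∈ ℤ} F(ω + 2kπ)`, a function on `𝕋`. For `F ∈ L¹(ℝ)` the
series converges absolutely for almost every `ω`. -/
def per {E : Type*} [NormedAddCommGroup E] (F : ℝ → E) : Torus → E :=
  (per_periodic F).lift

/-- The transfer operator
`(R_{m₀,m₀'} f)(z) = (1/N) ∑_{w^N = z} conj(m₀(w)) m₀'(w) f(w)` on functions on `𝕋`. -/
def transfer (N : ℕ) (m₀ m₀' : Torus → ℂ) (f : Torus → ℂ) (z : Torus) : ℂ :=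
  (1 / (N : ℂ)) * ∑ᶠ w ∈ {w : Torus | N • w = z}, conj (m₀ w) * m₀' w * f w

end Wavelet

end

noncomputable section

namespace Wavelet

/-! Taking Fourier transforms, the scaling equations give `N v(Nω) = W(ω) v(ω)` for `v = conj(φ̂)
φ̂'` and `W = conj(m₀) m₀'`. A dilation invariant factor `f` does not disturb this relation.
Splitting the sum over `ℤ` into residue classes mod `N` then shows that `Per(f v)` is fixed by the
transfer operator, and Cauchy–Schwarz on each orbit gives the bound (`per_mul_hat_properties`).

For the other direction, `h₀` has to be lifted from the circle to the line. An integrable `F` on the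
line is determined by its images under `ω ↦ ω / N ^ n` mod `2π`, whose densities are `Per(N ^ n F(N
^ n ·))` (`ae_eq_of_per_dil`). The densities wanted are `k n = W(z) W(z^N) ⋯ W(z^{N^{n-1}}) h₀(z)`.
That `h₀` is fixed by the transfer operator, the adjoint of `z ↦ z ^ N`, says exactly that `k (n +
1)` pushes forward to `k n` (`setIntegral_wprod_succ`).

The bound on `h₀` dominates each `k n` by the matching density of `q = |φ̂|² + |φ̂'|²`. The
quotients, pulled back to the line, form bounded martingales for the finite measure `q dω`, and
their limit is the density of `F` relative to `q` (`exists_density_of_consistent`). The quadratic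
bound passes to the limit: `|F|² ≤ c |φ̂|² |φ̂'|²` (`exists_line_density`). Uniqueness gives `F` the
scaling relation of `v`, so `F / v` is bounded and dilation invariant where defined, and it extends
to `f` (`exists_dilation_invariant`). -/

/-! ### Dilation, the Fourier transform and the scaling equation -/

theorem coeFn_U (N : ℕ) (ψ : L2R) :
    ∀ᵐ x : ℝ, U N ψ x = ((Real.sqrt N)⁻¹ : ℂ) * ψ (x / N) :=
  (memLp_dilate N ψ).coeFn_toLp

theorem ae_comp_div {N : ℕ} (hN : 0 < N) {p : ℝ → Prop} (hp : ∀ᵐ x : ℝ, p x) :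
    ∀ᵐ x : ℝ, p (x / N) := by
  have := (qmp_mul (N : ℝ)⁻¹ (by positivity)).ae hp
  simpa only [div_eq_inv_mul] using this

theorem ae_comp_mul {N : ℕ} (hN : 0 < N) {p : ℝ → Prop} (hp : ∀ᵐ x : ℝ, p x) :
    ∀ᵐ x : ℝ, p (N * x) :=
  (qmp_mul (N : ℝ) (by positivity)).ae hp

theorem U_sub {N : ℕ} (hN : 0 < N) (ψ χ : L2R) : U N (ψ - χ) = U N ψ - U N χ := by
  apply Lp.ext
  filter_upwards [coeFn_U N (ψ - χ), coeFn_U N ψ, coeFn_U N χ, Lp.coeFn_sub (U N ψ) (U N χ),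
    ae_comp_div hN (Lp.coeFn_sub ψ χ)] with x h1 h2 h3 h4 h5
  rw [h1, h4, Pi.sub_apply, h2, h3, h5, Pi.sub_apply, mul_sub]

theorem norm_U {N : ℕ} (hN : 0 < N) (ψ : L2R) : ‖U N ψ‖ = ‖ψ‖ := by
  have hN' : (0 : ℝ) < N := by exact_mod_cast hN
  have key : ∀ χ : L2R, ‖χ‖ ^ 2 = ∫ x, ‖χ x‖ ^ 2 := by
    intro χ
    rw [← inner_self_eq_norm_sq (𝕜 := ℂ), L2.inner_def, ← integral_re]
    · simp [inner_self_eq_norm_sq_to_K, ← Complex.ofReal_pow]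
    · exact L2.integrable_inner χ χ
  have h2 : ‖U N ψ‖ ^ 2 = ‖ψ‖ ^ 2 := by
    rw [key, key]
    have : ∀ᵐ x : ℝ, ‖U N ψ x‖ ^ 2 = (N : ℝ)⁻¹ * ‖ψ (x / N)‖ ^ 2 := by
      filter_upwards [coeFn_U N ψ] with x hx
      rw [hx, norm_mul, mul_pow, norm_inv, Complex.norm_real, Real.norm_of_nonneg (by positivity),
        inv_pow, Real.sq_sqrt hN'.le]
    rw [integral_congr_ae this, integral_const_mul,
      Measure.integral_comp_div (fun x : ℝ => ‖ψ x‖ ^ 2) (N : ℝ), abs_of_pos hN', smul_eq_mul]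
    field_simp
  exact (sq_eq_sq₀ (norm_nonneg _) (norm_nonneg _)).1 h2

theorem continuous_U {N : ℕ} (hN : 0 < N) : Continuous (U N) :=
  (Isometry.of_dist_eq fun ψ χ => by
    rw [dist_eq_norm, ← U_sub hN, norm_U hN, dist_eq_norm]).continuous

theorem exists_dilate_schwartz {N : ℕ} (hN : 0 < N) (f : SchwartzMap ℝ ℂ) :
    ∃ g : SchwartzMap ℝ ℂ, ∀ x, g x = ((Real.sqrt N)⁻¹ : ℂ) * f (x / N) := by
  let A : ℝ ≃L[ℝ] ℝ := ContinuousLinearEquiv.unitsEquivAut ℝ (Units.mk0 (N : ℝ)⁻¹ (by positivity))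
  have hA : ∀ x, A x = x / N := fun x => by
    simp [A, div_eq_mul_inv]
  exact ⟨((Real.sqrt N)⁻¹ : ℂ) • SchwartzMap.compCLMOfContinuousLinearEquiv ℂ A f,
    fun x => by simp [hA]⟩

theorem fourier_dilate_div {N : ℕ} (hN : 0 < N) (f g : ℝ → ℂ)
    (hg : ∀ x, g x = ((Real.sqrt N)⁻¹ : ℂ) * f (x / N)) (x : ℝ) :
    ((Real.sqrt N)⁻¹ : ℂ) * 𝓕 g (x / N) = 𝓕 f x := by
  have hN' : (0 : ℝ) < N := by exact_mod_cast hN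
  rw [Real.fourier_real_eq, Real.fourier_real_eq]
  have : ∀ v : ℝ, Real.fourierChar (-(v * (x / N))) • g v =
      (fun y : ℝ => ((Real.sqrt N)⁻¹ : ℂ) * (Real.fourierChar (-(y * x)) • f y)) (v / N) := by
    intro v
    simp only [hg, Circle.smul_def, smul_eq_mul]
    rw [show v / N * x = v * (x / N) by ring]
    ring
  simp_rw [this]
  rw [Measure.integral_comp_div
    (fun y : ℝ => ((Real.sqrt N)⁻¹ : ℂ) * (Real.fourierChar (-(y * x)) • f y)) (N : ℝ),
    integral_const_mul, abs_of_pos hN', Complex.real_smul]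
  have hs : ((Real.sqrt N : ℝ) : ℂ) * (Real.sqrt N : ℝ) = N := by
    rw [← Complex.ofReal_mul, Real.mul_self_sqrt hN'.le]; simp
  have hs0 : ((Real.sqrt N : ℝ) : ℂ) ≠ 0 := by
    exact_mod_cast (Real.sqrt_pos.2 hN').ne'
  rw [Complex.ofReal_natCast, ← hs]
  generalize ∫ y : ℝ, Real.fourierChar (-(y * x)) • f y = I
  field_simp

theorem U_fourier_U_schwartz {N : ℕ} (hN : 0 < N) (f : SchwartzMap ℝ ℂ) :
    U N (𝓕 (U N (f.toLp 2)) : L2R) = (𝓕 (f.toLp 2) : L2R) := by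
  obtain ⟨g, hg⟩ := exists_dilate_schwartz hN f
  have hUg : U N (f.toLp 2) = g.toLp 2 := by
    apply Lp.ext
    filter_upwards [coeFn_U N (f.toLp 2), g.coeFn_toLp 2 volume,
      ae_comp_div hN (f.coeFn_toLp 2 volume)] with x h1 h2 h3
    rw [h1, h2, h3, hg]
  rw [hUg, SchwartzMap.toLp_fourier_eq, SchwartzMap.toLp_fourier_eq]
  apply Lp.ext
  filter_upwards [coeFn_U N ((𝓕 g).toLp 2), (𝓕 f).coeFn_toLp 2 volume,
    ae_comp_div hN ((𝓕 g).coeFn_toLp 2 volume)] with x h1 h2 h3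
  rw [h1, h2, h3, SchwartzMap.fourier_coe, SchwartzMap.fourier_coe]
  exact fourier_dilate_div hN f g hg x

/-- Dilation in time is the inverse dilation in frequency; this form avoids naming the inverse of
`U`. Both sides are continuous in `ψ`, so Schwartz functions suffice, and for them it is a change of
variables in the Fourier integral. -/
theorem U_fourier_U {N : ℕ} (hN : 0 < N) (ψ : L2R) :
    U N (𝓕 (U N ψ) : L2R) = (𝓕 ψ : L2R) := by
  have hF : Continuous (fun ψ : L2R => (𝓕 ψ : L2R)) := (Lp.fourierTransformₗᵢ ℝ ℂ).continuous
  refine DenseRange.induction_on (p := fun ψ : L2R => U N (𝓕 (U N ψ) : L2R) = (𝓕 ψ : L2R))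
    (SchwartzMap.denseRange_toLpCLM (F := ℂ) (μ := (volume : Measure ℝ)) (p := 2)
      ENNReal.ofNat_ne_top) ψ ?_ ?_
  · exact isClosed_eq ((continuous_U hN).comp (hF.comp (continuous_U hN))) hF
  exact U_fourier_U_schwartz hN

theorem hat_U {N : ℕ} (hN : 0 < N) (ψ : L2R) :
    ∀ᵐ ω : ℝ, hat (U N ψ) ω = (Real.sqrt N : ℂ) * hat ψ (N * ω) := by
  have hN' : (0 : ℝ) < N := by exact_mod_cast hN
  have h := coeFn_U N (𝓕 (U N ψ) : L2R)
  rw [U_fourier_U hN] at h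
  have h2 := ae_comp_mul hN ((qmp_mul (2 * Real.pi)⁻¹ (by positivity)).ae h)
  filter_upwards [h2] with ω hω
  rw [hat, hat, div_eq_inv_mul, div_eq_inv_mul, hω,
    show (2 * Real.pi)⁻¹ * (N * ω) / N = (2 * Real.pi)⁻¹ * ω by field_simp]
  have hs0 : ((Real.sqrt N : ℝ) : ℂ) ≠ 0 := by
    exact_mod_cast (Real.sqrt_pos.2 hN').ne'
  field_simp

theorem IsWaveletRep.scaling {N : ℕ} (hN : 0 < N) {φ : L2R} {m₀ : LinfT}
    (hφ : IsWaveletRep N φ m₀) :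
    ∀ᵐ ω : ℝ, (Real.sqrt N : ℂ) * hat φ (N * ω) = m₀ (ω : Torus) * hat φ ω := by
  filter_upwards [hat_U hN φ, hat_rep m₀ φ] with ω h1 h2
  rw [← h1, hφ, h2]

theorem stronglyMeasurable_hat (ψ : L2R) : StronglyMeasurable (hat ψ) :=
  (Lp.stronglyMeasurable (𝓕 ψ : L2R)).comp_measurable (measurable_id.div_const _)

theorem memLp_hat (ψ : L2R) : MemLp (hat ψ) 2 volume := by
  have ha : (2 * Real.pi)⁻¹ ≠ 0 := by positivity
  have hm : MemLp (𝓕 ψ : L2R) 2 (Measure.map (fun x : ℝ => (2 * Real.pi)⁻¹ * x) volume) := by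
    rw [Real.map_volume_mul_left ha]
    exact (Lp.memLp (𝓕 ψ : L2R)).smul_measure ENNReal.ofReal_ne_top
  have := hm.comp_of_map (by fun_prop)
  refine this.congr_norm (stronglyMeasurable_hat ψ).aestronglyMeasurable ?_
  exact Filter.Eventually.of_forall fun x => by simp [hat, div_eq_inv_mul]

/-! ### The line as translates of a fundamental interval, and almost everywhere statements on the
circle -/

/-- Lebesgue measure on the fundamental interval `(0, 2π]`. -/
abbrev μI : Measure ℝ := volume.restrict (Set.Ioc 0 (0 + 2 * Real.pi))

theorem volume_eq_sum_map_add :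
    (volume : Measure ℝ) =
      Measure.sum fun k : ℤ => μI.map (fun ω => ω + 2 * k * Real.pi) := by
  have h1 := Measure.restrict_iUnion (μ := (volume : Measure ℝ))
    (Set.pairwise_disjoint_Ioc_add_zsmul (0 : ℝ) (2 * Real.pi)) (fun _ => measurableSet_Ioc)
  rw [iUnion_Ioc_add_zsmul Real.two_pi_pos, Measure.restrict_univ] at h1
  rw [h1]
  congr 1
  funext k
  have hm := (measurePreserving_add_right (volume : Measure ℝ)
    (2 * (k : ℝ) * Real.pi)).restrict_preimage (s := Set.Ioc (0 + k • (2 * Real.pi))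
      (0 + (k + 1) • (2 * Real.pi))) measurableSet_Ioc
  rw [← hm.map_eq]
  congr 2
  ext ω
  simp only [Set.mem_preimage, Set.mem_Ioc, zsmul_eq_mul, Int.cast_add, Int.cast_one]
  constructor <;> rintro ⟨h1, h2⟩ <;> constructor <;> linarith

theorem measurePreserving_coe :
    MeasurePreserving (fun ω : ℝ => (ω : Torus)) μI volume :=
  AddCircle.measurePreserving_mk (2 * Real.pi) 0

/-- The representative in `(0, 2π]` of a point of the circle. -/
def rep₀ (z : Torus) : ℝ := AddCircle.measurableEquivIoc (2 * Real.pi) 0 z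

theorem coe_rep₀ (z : Torus) : (rep₀ z : Torus) = z :=
  (AddCircle.measurableEquivIoc (2 * Real.pi) 0).symm_apply_apply z

theorem rep₀_coe {ω : ℝ} (hω : ω ∈ Set.Ioc 0 (0 + 2 * Real.pi)) : rep₀ (ω : Torus) = ω :=
  congrArg Subtype.val
    ((AddCircle.measurableEquivIoc (2 * Real.pi) 0).apply_symm_apply ⟨ω, hω⟩)

theorem measurable_rep₀ : Measurable rep₀ :=
  measurable_subtype_coe.comp (AddCircle.measurableEquivIoc (2 * Real.pi) 0).measurable

theorem measurePreserving_rep₀ : MeasurePreserving rep₀ volume μI := by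
  refine ⟨measurable_rep₀, ?_⟩
  rw [← measurePreserving_coe.map_eq, Measure.map_map measurable_rep₀ AddCircle.measurable_mk']
  conv_rhs => rw [← Measure.map_id (μ := μI)]
  refine Measure.map_congr ?_
  filter_upwards [ae_restrict_mem measurableSet_Ioc] with ω hω
  exact rep₀_coe hω

theorem ae_torus_iff {p : Torus → Prop} :
    (∀ᵐ z : Torus, p z) ↔ ∀ᵐ (ω : ℝ) ∂μI, p (ω : Torus) := by
  refine ⟨fun h => measurePreserving_coe.quasiMeasurePreserving.ae h, fun h => ?_⟩
  filter_upwards [measurePreserving_rep₀.quasiMeasurePreserving.ae h] with z hz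
  rwa [coe_rep₀] at hz

theorem ae_haar_iff {p : Torus → Prop} : (∀ᵐ z ∂μT, p z) ↔ ∀ᵐ z : Torus, p z := by
  have h : (volume : Measure Torus) = ENNReal.ofReal (2 * Real.pi) • μT :=
    AddCircle.volume_eq_smul_haarAddCircle
  rw [h, ae_iff, ae_iff, Measure.smul_apply, smul_eq_mul, mul_eq_zero]
  have : ¬ (ENNReal.ofReal (2 * Real.pi) = 0) := by
    simp [Real.pi_pos]
  simp only [this, false_or]

theorem integrable_haar_iff {f : Torus → ℂ} : Integrable f μT ↔ Integrable f volume := by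
  have h : (volume : Measure Torus) = ENNReal.ofReal (2 * Real.pi) • μT :=
    AddCircle.volume_eq_smul_haarAddCircle
  rw [h, integrable_smul_measure (by simp [Real.pi_pos]) ENNReal.ofReal_ne_top]

theorem qmp_shift (k : ℤ) :
    Measure.QuasiMeasurePreserving (fun ω : ℝ => ω + 2 * k * Real.pi) μI volume :=
  ((measurePreserving_add_right (volume : Measure ℝ)
    (2 * (k : ℝ) * Real.pi)).quasiMeasurePreserving).mono_left
      Measure.restrict_le_self.absolutelyContinuous

theorem ae_shift {p : ℝ → Prop} (h : ∀ᵐ ω : ℝ, p ω) :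
    ∀ᵐ ω ∂μI, ∀ k : ℤ, p (ω + 2 * k * Real.pi) := by
  rw [ae_all_iff]
  intro k
  exact (qmp_shift k).ae h

theorem ae_of_ae_torus {p : Torus → Prop} (h : ∀ᵐ z : Torus, p z) : ∀ᵐ ω : ℝ, p (ω : Torus) :=
  qmp_mk.ae (ae_haar_iff.2 h)

theorem ae_torus_of_ae {p : Torus → Prop} (h : ∀ᵐ ω : ℝ, p (ω : Torus)) : ∀ᵐ z : Torus, p z :=
  ae_torus_iff.2 (ae_restrict_of_ae h)

theorem qmp_coe :
    Measure.QuasiMeasurePreserving (fun ω : ℝ => (ω : Torus)) volume volume := by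
  refine ⟨AddCircle.measurable_mk', qmp_mk.2.trans ?_⟩
  exact Measure.AbsolutelyContinuous.mk fun s _ h => by
    have := (ae_haar_iff (p := fun z => z ∉ s)).2 (by simpa [ae_iff] using h)
    simpa [ae_iff] using this

/-! ### Periodization -/

section Per

variable {E : Type*} [NormedAddCommGroup E]

theorem per_coe (F : ℝ → E) (ω : ℝ) :
    per F (ω : Torus) = ∑' k : ℤ, F (ω + 2 * k * Real.pi) := rfl

theorem coe_add_two_pi (ω : ℝ) (k : ℤ) : ((ω + 2 * k * Real.pi : ℝ) : Torus) = ω := by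
  rw [show (2 * k * Real.pi : ℝ) = k • (2 * Real.pi) by rw [zsmul_eq_mul]; ring,
    AddCircle.coe_add, AddCircle.coe_zsmul, AddCircle.coe_period, smul_zero, add_zero]

theorem per_congr {F G : ℝ → E} (h : ∀ᵐ ω : ℝ, F ω = G ω) : ∀ᵐ z : Torus, per F z = per G z := by
  rw [ae_torus_iff]
  filter_upwards [ae_shift h] with ω hω
  rw [per_coe, per_coe]
  exact tsum_congr hω

theorem per_mul {𝕜 : Type*} [NormedField 𝕜] (g : Torus → 𝕜) (F : ℝ → 𝕜) (z : Torus) :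
    per (fun ω => g (ω : Torus) * F ω) z = g z * per F z := by
  obtain ⟨ω, rfl⟩ : ∃ ω : ℝ, (ω : Torus) = z := ⟨_, coe_rep₀ z⟩
  rw [per_coe, per_coe, ← tsum_mul_left]
  exact tsum_congr fun k => by rw [coe_add_two_pi]

theorem lintegral_eq_tsum_shift {f : ℝ → ℝ≥0∞} (hf : AEMeasurable f) :
    ∫⁻ ω, f ω = ∫⁻ ω, ∑' k : ℤ, f (ω + 2 * k * Real.pi) ∂μI := by
  rw [lintegral_tsum (f := fun (k : ℤ) (ω : ℝ) => f (ω + 2 * k * Real.pi))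
    fun k => hf.comp_quasiMeasurePreserving (qmp_shift k)]
  conv_lhs => rw [volume_eq_sum_map_add]
  rw [lintegral_sum_measure]
  refine tsum_congr fun k => ?_
  have hf' : AEMeasurable f (μI.map fun ω => ω + 2 * k * Real.pi) :=
    hf.mono_ac (qmp_shift k).absolutelyContinuous
  rw [lintegral_map' hf' (qmp_shift k).measurable.aemeasurable]

theorem ae_summable_norm_shift {F : ℝ → E} (hF : Integrable F) :
    ∀ᵐ ω ∂μI, Summable fun k : ℤ => ‖F (ω + 2 * k * Real.pi)‖ := by
  have h := lintegral_eq_tsum_shift hF.1.enorm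
  have h2 : ∫⁻ ω, ∑' k : ℤ, ‖F (ω + 2 * k * Real.pi)‖ₑ ∂μI ≠ ∞ := by
    rw [← h]; exact hF.2.ne
  have hm : AEMeasurable (fun ω => ∑' k : ℤ, ‖F (ω + 2 * k * Real.pi)‖ₑ) μI := by
    refine AEMeasurable.tsum fun k => ?_
    exact hF.1.enorm.comp_quasiMeasurePreserving (qmp_shift k)
  filter_upwards [ae_lt_top' hm h2] with ω hω
  have := ENNReal.summable_toReal hω.ne
  simpa using this

theorem integrable_per_aux [CompleteSpace E] {F : ℝ → E} (hF : Integrable F) :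
    Integrable (fun ω => ∑' k : ℤ, F (ω + 2 * k * Real.pi)) μI := by
  refine ⟨?_, ?_⟩
  · refine aestronglyMeasurable_of_tendsto_ae (u := Filter.atTop)
      (f := fun (s : Finset ℤ) ω => ∑ k ∈ s, F (ω + 2 * k * Real.pi)) (fun s => ?_) ?_
    · exact Finset.aestronglyMeasurable_fun_sum _
        fun k _ => hF.1.comp_quasiMeasurePreserving (qmp_shift k)
    · filter_upwards [ae_summable_norm_shift hF] with ω hω
      exact hω.of_norm.hasSum
  · have h := lintegral_eq_tsum_shift hF.1.enorm
    refine lt_of_le_of_lt (lintegral_mono_ae ?_) (h.symm.trans_lt hF.2)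
    filter_upwards [ae_summable_norm_shift hF] with ω hω
    exact enorm_tsum_le_tsum_enorm 

theorem integrable_per [CompleteSpace E] {F : ℝ → E} (hF : Integrable F) : Integrable (per F) volume := by
  have := measurePreserving_rep₀.integrable_comp_of_integrable (integrable_per_aux hF)
  refine this.congr (Filter.Eventually.of_forall fun z => ?_)
  simp only [Function.comp]
  rw [← per_coe, coe_rep₀]

theorem integral_per [NormedSpace ℝ E] {F : ℝ → E} (hF : Integrable F) : ∫ z : Torus, per F z = ∫ ω, F ω := by
  rw [← AddCircle.integral_preimage (2 * Real.pi) 0 (per F)]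
  simp_rw [per_coe]
  rw [integral_tsum (f := fun (k : ℤ) (ω : ℝ) => F (ω + 2 * k * Real.pi))
    (fun k => hF.1.comp_quasiMeasurePreserving (qmp_shift k))]
  · have hF' := hF
    rw [volume_eq_sum_map_add] at hF'
    have := (hasSum_integral_measure hF').tsum_eq
    rw [← volume_eq_sum_map_add] at this
    rw [← this]
    refine tsum_congr fun k => ?_
    rw [integral_map (qmp_shift k).measurable.aemeasurable (hF.1.mono_ac (qmp_shift k).absolutelyContinuous)]
  · rw [← lintegral_tsum (f := fun (k : ℤ) (ω : ℝ) => ‖F (ω + 2 * k * Real.pi)‖ₑ)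
      fun k => hF.1.enorm.comp_quasiMeasurePreserving (qmp_shift k),
      ← lintegral_eq_tsum_shift hF.1.enorm]
    exact hF.2.ne

end Per

/-- Unfolding: a periodic factor comes out of the periodization, so `per F` is the density on the
circle of the image of `F dω`. -/
theorem integral_coe_mul {𝕜 : Type*} [RCLike 𝕜] {F : ℝ → 𝕜} (hF : Integrable F) {g : Torus → 𝕜}
    (hg : AEStronglyMeasurable g volume) {C : ℝ} (hC : ∀ᵐ z, ‖g z‖ ≤ C) :
    ∫ ω : ℝ, g (ω : Torus) * F ω = ∫ z : Torus, g z * per F z := by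
  rw [← integral_per]
  · simp_rw [per_mul]
  · refine hF.bdd_mul (c := C) ?_ (ae_of_ae_torus hC)
    exact hg.comp_quasiMeasurePreserving qmp_coe

/-! ### Torsion points and fixed points of the transfer operator -/

/-- The `N`-torsion points of the circle. -/
def torsion (N : ℕ) (j : Fin N) : Torus := (((j : ℕ) • (2 * Real.pi / N) : ℝ) : Torus)

theorem torsion_injective {N : ℕ} (hN : 0 < N) : Function.Injective (torsion N) := by
  have hN' : (0 : ℝ) < N := by exact_mod_cast hN
  have hmem : ∀ j : Fin N, ((j : ℕ) • (2 * Real.pi / N) : ℝ) ∈ Set.Ico 0 (0 + 2 * Real.pi) := by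
    intro j
    have hj : ((j : ℕ) : ℝ) < N := by exact_mod_cast j.2
    rw [nsmul_eq_mul]
    refine ⟨by positivity, ?_⟩
    rw [zero_add, mul_div_assoc', div_lt_iff₀ hN', mul_comm]
    exact mul_lt_mul_of_pos_left hj Real.two_pi_pos
  intro i j hij
  have := (AddCircle.coe_eq_coe_iff_of_mem_Ico (hmem i) (hmem j)).1 hij
  rw [nsmul_eq_mul, nsmul_eq_mul] at this
  have h2 : (2 * Real.pi / N : ℝ) ≠ 0 := by positivity
  exact Fin.ext (by exact_mod_cast mul_right_cancel₀ h2 this)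

/-- At a point already written as `N • z`, the fibre is the coset of `z` under the `N`-torsion, so
no root has to be chosen. Almost everywhere statements lose nothing by this, by
`ae_torus_of_ae_nsmul`. -/
theorem transfer_nsmul {N : ℕ} (hN : 0 < N) (m m' g : Torus → ℂ) (z : Torus) :
    transfer N m m' g (N • z) = (1 / (N : ℂ)) * ∑ j : Fin N,
      conj (m (z + torsion N j)) * m' (z + torsion N j) * g (z + torsion N j) := by
  have hs : {w : Torus | N • w = N • z} = Set.range fun j => z + torsion N j := by
    ext w
    simp only [Set.mem_ofPred_eq, Set.mem_range]
    refine (QuotientAddGroup.zmultiples_nsmul_eq_nsmul_iff hN.ne').trans ?_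
    exact exists_congr fun j => eq_comm
  rw [transfer, hs, finsum_mem_range (fun _ _ h => torsion_injective hN (add_right_injective z h)),
    finsum_eq_sum_of_fintype]

theorem coe_natCast_mul (N : ℕ) (ω : ℝ) : ((N * ω : ℝ) : Torus) = N • (ω : Torus) := by
  rw [← nsmul_eq_mul, AddCircle.coe_nsmul]

theorem ae_of_ae_comp_mul {N : ℕ} (hN : 0 < N) {p : ℝ → Prop} (hp : ∀ᵐ x : ℝ, p (N * x)) :
    ∀ᵐ x : ℝ, p x := by
  have hN' : (0 : ℝ) < N := by exact_mod_cast hN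
  filter_upwards [ae_comp_div hN hp] with x hx
  rwa [mul_div_cancel₀ _ hN'.ne'] at hx

theorem ae_torus_of_ae_nsmul {N : ℕ} (hN : 0 < N) {p : Torus → Prop}
    (hp : ∀ᵐ ω : ℝ, p (N • (ω : Torus))) : ∀ᵐ z : Torus, p z := by
  refine ae_torus_of_ae (ae_of_ae_comp_mul hN ?_)
  simpa only [coe_natCast_mul] using hp

theorem ae_add_torsion {N : ℕ} {p : Torus → Prop} (hp : ∀ᵐ z : Torus, p z) :
    ∀ᵐ z : Torus, ∀ j : Fin N, p (z + torsion N j) :=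
  ae_all_iff.2 fun j =>
    (measurePreserving_add_right (volume : Measure Torus) (torsion N j)).quasiMeasurePreserving.ae hp

/-- Summability depends only on the orbit of `ω` under `2πℤ`, so the statement on the fundamental
interval spreads to the whole line. -/
theorem ae_summable_shift {F : ℝ → ℂ} (hF : Integrable F) :
    ∀ᵐ ω : ℝ, Summable fun k : ℤ => ‖F (ω + 2 * k * Real.pi)‖ := by
  have h : ∀ᵐ z : Torus, ∃ ω : ℝ, (ω : Torus) = z ∧
      Summable fun k : ℤ => ‖F (ω + 2 * k * Real.pi)‖ := by
    rw [ae_torus_iff]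
    filter_upwards [ae_summable_norm_shift hF] with ω hω
    exact ⟨ω, rfl, hω⟩
  filter_upwards [ae_of_ae_torus h] with ω hω
  obtain ⟨ω', h1, h2⟩ := hω
  obtain ⟨n, hn⟩ := (QuotientAddGroup.eq_iff_sub_mem.1 h1)
  refine ((Equiv.subRight n).summable_iff.2 h2).congr fun k => ?_
  simp only [Function.comp, Equiv.subRight_apply, Int.cast_sub]
  simp only [zsmul_eq_mul] at hn
  congr 2
  linarith

/-- If `N F(Nω) = conj(m(ω)) m'(ω) F(ω)`, then `Per F` is a fixed point of the transfer operator. -/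
theorem transfer_per {N : ℕ} (hN : 0 < N) {m m' : Torus → ℂ} {F : ℝ → ℂ} (hF : Integrable F)
    (hs : ∀ᵐ ω : ℝ, (N : ℂ) * F (N * ω) = conj (m (ω : Torus)) * m' (ω : Torus) * F ω)
    {g : Torus → ℂ} (hg : ∀ᵐ z : Torus, g z = per F z) :
    ∀ᵐ z : Torus, transfer N m m' g z = g z := by
  have hN' : (0 : ℝ) < N := by exact_mod_cast hN
  have : NeZero N := ⟨hN.ne'⟩
  have hT : ∀ᵐ z : Torus, g z = per F z ∧
      per (fun ω => (N : ℂ) * F (N * ω)) z = conj (m z) * m' z * per F z := by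
    filter_upwards [hg, per_congr hs] with z h1 h2
    exact ⟨h1, h2.trans (per_mul (fun z => conj (m z) * m' z) F z)⟩
  refine ae_torus_of_ae_nsmul hN ?_
  filter_upwards [ae_of_ae_torus (ae_add_torsion (N := N) hT),
    ae_comp_mul hN (ae_summable_shift hF),
    ae_comp_mul hN (ae_of_ae_torus hg)] with ω h1 h2 h3
  rw [transfer_nsmul hN, ← coe_natCast_mul, h3, per_coe]
  -- The `j`-th root contributes the translates of `N * ω` whose index is congruent to `j` modulo
  -- `N`.
  have h4 : ∀ j : Fin N, conj (m (ω + torsion N j)) * m' (ω + torsion N j) * g (ω + torsion N j) =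
      (N : ℂ) * ∑' k : ℤ, F (N * ω + 2 * ((k * N + (j : ℕ) : ℤ) : ℝ) * Real.pi) := by
    intro j
    rw [(h1 j).1, ← (h1 j).2, torsion, ← AddCircle.coe_add, per_coe, ← tsum_mul_left]
    refine tsum_congr fun k => ?_
    congr 2
    rw [nsmul_eq_mul]
    push_cast
    field_simp
    ring
  rw [Finset.sum_congr rfl fun j _ => h4 j, ← Finset.mul_sum, ← mul_assoc,
    one_div_mul_cancel (by exact_mod_cast hN.ne'), one_mul]
  -- Euclidean division by `N` reassembles the residue classes into one sum over `ℤ`.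
  have h5 : Summable fun q : Fin N × ℤ =>
      F (N * ω + 2 * ((q.2 * N + (q.1 : ℕ) : ℤ) : ℝ) * Real.pi) :=
    ((((Equiv.prodComm _ _).trans (Int.divModEquiv N).symm).summable_iff).2 h2.of_norm).congr
      fun q => by simp [Int.divModEquiv_symm_apply]
  rw [← tsum_fintype (L := .unconditional _), ← h5.tsum_prod,
    ← ((Equiv.prodComm _ _).trans (Int.divModEquiv N).symm).tsum_eq]
  exact tsum_congr fun q => by simp [Int.divModEquiv_symm_apply]

/-! ### Cauchy–Schwarz on orbits and the converse direction -/

theorem sq_tsum_mul_le {u v : ℤ → ℝ} (hu : ∀ k, 0 ≤ u k) (hv : ∀ k, 0 ≤ v k)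
    (hu2 : Summable fun k => u k ^ 2) (hv2 : Summable fun k => v k ^ 2) :
    (∑' k, u k * v k) ^ 2 ≤ (∑' k, u k ^ 2) * ∑' k, v k ^ 2 := by
  have h := Real.inner_le_Lp_mul_Lq_tsum_of_nonneg (p := 2) (q := 2) Real.HolderConjugate.two_two
    hu hv (by simpa using hu2) (by simpa using hv2)
  simp only [Real.rpow_two, ← Real.sqrt_eq_rpow] at h
  refine (pow_le_pow_left₀ (tsum_nonneg fun k => mul_nonneg (hu k) (hv k)) h 2).trans_eq ?_
  rw [mul_pow, Real.sq_sqrt (tsum_nonneg fun k => sq_nonneg _),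
    Real.sq_sqrt (tsum_nonneg fun k => sq_nonneg _)]

theorem integrable_norm_sq_hat (φ : L2R) : Integrable fun ω => ‖hat φ ω‖ ^ 2 :=
  (memLp_hat φ).integrable_norm_pow (by norm_num)

theorem ae_norm_le_norm_linf {α : Type*} [MeasurableSpace α] {μ : Measure α} (f : Lp ℂ ∞ μ) :
    ∀ᵐ x ∂μ, ‖f x‖ ≤ ‖f‖ := by
  filter_upwards [ae_le_eLpNormEssSup (f := f) (μ := μ)] with z hz
  rw [Lp.norm_def, eLpNorm_exponent_top]
  exact (toReal_enorm (f z)).symm.trans_le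
    (ENNReal.toReal_mono (by simpa using (Lp.memLp f).2.ne) hz)

/-- Cauchy–Schwarz over each orbit gives the factor `‖f‖ ^ 2`; the `+ 1` keeps the constant positive
when `f = 0`. -/
theorem norm_sq_per_le (f : LinfR) (φ φ' : L2R) :
    ∀ᵐ z : Torus, ‖per (fun ω => f ω * conj (hat φ ω) * hat φ' ω) z‖ ^ 2 ≤
      (‖f‖ ^ 2 + 1) * per (fun ω => ‖hat φ ω‖ ^ 2) z * per (fun ω => ‖hat φ' ω‖ ^ 2) z := by
  have hf : ∀ᵐ ω : ℝ, ‖f ω‖ ≤ ‖f‖ := ae_norm_le_norm_linf f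
  rw [ae_torus_iff]
  filter_upwards [ae_shift hf, ae_summable_norm_shift (integrable_norm_sq_hat φ),
    ae_summable_norm_shift (integrable_norm_sq_hat φ')] with ω h1 h2 h3
  simp only [norm_pow, norm_norm] at h2 h3
  simp only [per_coe]
  have hsum : Summable fun k : ℤ => ‖hat φ (ω + 2 * k * Real.pi)‖ * ‖hat φ' (ω + 2 * k * Real.pi)‖ := by
    refine Summable.of_nonneg_of_le (fun k => by positivity) (fun k => ?_) (h2.add h3)
    nlinarith [sq_nonneg (‖hat φ (ω + 2 * k * Real.pi)‖ - ‖hat φ' (ω + 2 * k * Real.pi)‖),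
      sq_nonneg (‖hat φ (ω + 2 * k * Real.pi)‖), sq_nonneg (‖hat φ' (ω + 2 * k * Real.pi)‖)]
  have hle : ‖∑' k : ℤ, f (ω + 2 * k * Real.pi) * conj (hat φ (ω + 2 * k * Real.pi)) *
      hat φ' (ω + 2 * k * Real.pi)‖ ≤
      ‖f‖ * ∑' k : ℤ, ‖hat φ (ω + 2 * k * Real.pi)‖ * ‖hat φ' (ω + 2 * k * Real.pi)‖ := by
    rw [← tsum_mul_left]
    refine tsum_of_norm_bounded (hsum.mul_left _).hasSum fun k => ?_
    rw [norm_mul, norm_mul, RCLike.norm_conj, mul_assoc]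
    exact mul_le_mul_of_nonneg_right (h1 k) (by positivity)
  have hcs := sq_tsum_mul_le (fun k => norm_nonneg (hat φ (ω + 2 * k * Real.pi)))
    (fun k => norm_nonneg (hat φ' (ω + 2 * k * Real.pi))) h2 h3
  refine (pow_le_pow_left₀ (norm_nonneg _) hle 2).trans ?_
  rw [mul_pow, mul_assoc]
  exact mul_le_mul (by linarith) hcs (by positivity) (by positivity)

theorem integrable_mul_hat {f : ℝ → ℂ} (hf : AEStronglyMeasurable f) {C : ℝ}
    (hC : ∀ᵐ ω : ℝ, ‖f ω‖ ≤ C) (φ φ' : L2R) :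
    Integrable fun ω => f ω * conj (hat φ ω) * hat φ' ω := by
  have h : Integrable fun ω => conj (hat φ ω) * hat φ' ω :=
    (memLp_hat φ).star.integrable_mul (memLp_hat φ')
  simpa only [mul_assoc] using h.bdd_mul hf hC

theorem hat_mul_scaling {N : ℕ} (hN : 0 < N) {φ φ' : L2R} {m₀ m₀' : LinfT}
    (hφ : IsWaveletRep N φ m₀) (hφ' : IsWaveletRep N φ' m₀') :
    ∀ᵐ ω : ℝ, (N : ℂ) * (conj (hat φ (N * ω)) * hat φ' (N * ω)) =
      conj (m₀ (ω : Torus)) * m₀' (ω : Torus) * (conj (hat φ ω) * hat φ' ω) := by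
  filter_upwards [hφ.scaling hN, hφ'.scaling hN] with ω h1 h2
  have hs : ((Real.sqrt N : ℝ) : ℂ) * (Real.sqrt N : ℝ) = N := by
    rw [← Complex.ofReal_mul, Real.mul_self_sqrt (Nat.cast_nonneg N)]; simp
  have h3 := congrArg conj h1
  rw [map_mul, map_mul, Complex.conj_ofReal] at h3
  rw [← hs]
  linear_combination h3 * (Real.sqrt N * hat φ' (N * ω)) + conj (m₀ (ω : Torus)) * conj (hat φ ω) * h2

/-- The periodization of `f conj(φ̂) φ̂'` for a dilation invariant bounded `f`. -/
theorem per_mul_hat_properties {N : ℕ} (hN : 0 < N) {φ φ' : L2R} {m₀ m₀' : LinfT}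
    (hφ : IsWaveletRep N φ m₀) (hφ' : IsWaveletRep N φ' m₀') (f : LinfR)
    (hf : ∀ᵐ x : ℝ, f (N * x) = f x) {h₀ : Torus → ℂ}
    (hh : ∀ᵐ z : Torus, h₀ z = per (fun ω => f ω * conj (hat φ ω) * hat φ' ω) z) :
    Integrable h₀ volume ∧ (∀ᵐ z : Torus, transfer N m₀ m₀' h₀ z = h₀ z) ∧
      ∀ᵐ z : Torus, ‖h₀ z‖ ^ 2 ≤ (‖f‖ ^ 2 + 1) *
        per (fun ω => ‖hat φ ω‖ ^ 2) z * per (fun ω => ‖hat φ' ω‖ ^ 2) z := by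
  have hF := integrable_mul_hat (Lp.aestronglyMeasurable f) (ae_norm_le_norm_linf f) φ φ'
  refine ⟨(integrable_per hF).congr (hh.mono fun z hz => hz.symm), transfer_per hN hF ?_ hh, ?_⟩
  · filter_upwards [hf, hat_mul_scaling hN hφ hφ'] with ω h1 h2
    rw [h1]
    linear_combination f ω * h2
  · filter_upwards [hh, norm_sq_per_le f φ φ'] with z h1 h2
    rw [h1]
    exact h2

/-! ### Bounded martingales and the filtration of periodic sets -/

open Filter Topology

/-- A uniform bound on a finite measure space gives almost everywhere convergence by Doob's theorem.
It also allows dominated convergence, so the limit keeps the integrals over the sets of each stage.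
-/
theorem exists_tendsto_of_bounded_martingale {Ω : Type*} {m : MeasurableSpace Ω} {μ : Measure Ω}
    [IsFiniteMeasure μ] {ℱ : Filtration ℕ m} {f : ℕ → Ω → ℝ} (hf : StronglyAdapted ℱ f) {C : ℝ}
    (hC : ∀ n, ∀ᵐ ω ∂μ, ‖f n ω‖ ≤ C)
    (hs : ∀ n, ∀ s : Set Ω, MeasurableSet[ℱ n] s → ∫ ω in s, f n ω ∂μ = ∫ ω in s, f (n + 1) ω ∂μ) :
    ∃ X : Ω → ℝ, Measurable X ∧ (∀ᵐ ω ∂μ, Tendsto (fun n => f n ω) atTop (𝓝 (X ω))) ∧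
      ∀ n, ∀ s : Set Ω, MeasurableSet[ℱ n] s → ∫ ω in s, X ω ∂μ = ∫ ω in s, f n ω ∂μ := by
  have hsm : ∀ n, StronglyMeasurable (f n) := fun n => (hf n).mono (ℱ.le n)
  have hint : ∀ n, Integrable (f n) μ := fun n =>
    Integrable.of_bound (hsm n).aestronglyMeasurable C (hC n)
  have hM := martingale_of_setIntegral_eq_succ hf hint hs
  have hbdd : ∀ n, eLpNorm (f n) 1 μ ≤ ((μ Set.univ).toNNReal * C.toNNReal : NNReal) := by
    intro n
    refine (eLpNorm_le_of_ae_bound (hC n)).trans ?_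
    simp [ENNReal.ofReal, ENNReal.coe_toNNReal (measure_ne_top μ _)]
  obtain ⟨X, hmeas, hlim⟩ := measurable_limit_of_tendsto_metrizable_ae
    (fun n => (hsm n).measurable.aemeasurable) (hM.submartingale.exists_ae_tendsto_of_bdd hbdd)
  refine ⟨X, hmeas, hlim, fun n s hmem => ?_⟩
  have hsucc : ∀ k, n ≤ k → ∫ ω in s, f k ω ∂μ = ∫ ω in s, f n ω ∂μ := by
    intro k hk
    induction k, hk using Nat.le_induction with
    | base => rfl
    | succ k hk ih => rw [← hs k s (ℱ.mono hk _ hmem), ih]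
  have hdom : Tendsto (fun k => ∫ ω in s, f k ω ∂μ) atTop
      (𝓝 (∫ ω in s, X ω ∂μ)) :=
    tendsto_integral_of_dominated_convergence (fun _ => C)
      (fun k => (hsm k).aestronglyMeasurable) (integrable_const C)
      (fun k => ae_restrict_of_ae (hC k)) (ae_restrict_of_ae hlim)
  refine tendsto_nhds_unique hdom (tendsto_const_nhds.congr' ?_)
  filter_upwards [eventually_ge_atTop n] with k hk using (hsucc k hk).symm

/-- The projection `ω ↦ ω / N ^ n` of the line onto the circle. -/
def proj (N n : ℕ) (ω : ℝ) : Torus := ((ω / (N : ℝ) ^ n : ℝ) : Torus)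

theorem measurable_proj (N n : ℕ) : Measurable (proj N n) :=
  AddCircle.measurable_mk'.comp (measurable_id.div_const _)

theorem nsmul_proj_succ {N : ℕ} (hN : 0 < N) (n : ℕ) (ω : ℝ) :
    N • proj N (n + 1) ω = proj N n ω := by
  have hN' : (0 : ℝ) < N := by exact_mod_cast hN
  rw [proj, proj, ← coe_natCast_mul, pow_succ]
  congr 1
  field_simp

theorem measurable_nsmul_torus (N : ℕ) : Measurable fun z : Torus => N • z :=
  (continuous_nsmul N).measurable

theorem ae_proj {N : ℕ} (hN : 0 < N) (n : ℕ) {p : Torus → Prop} (hp : ∀ᵐ z : Torus, p z) :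
    ∀ᵐ ω : ℝ, p (proj N n ω) := by
  have := ae_comp_div (pow_pos hN n) (ae_of_ae_torus hp)
  filter_upwards [this] with ω hω
  rwa [Nat.cast_pow] at hω

/-- The increasing sequence of the σ-algebras of the sets of period `2πN^n`. -/
def periodicFiltration {N : ℕ} (hN : 0 < N) : Filtration ℕ Real.measurableSpace where
  seq n := MeasurableSpace.comap (proj N n) inferInstance
  mono' := by
    refine monotone_nat_of_le_succ fun n => ?_
    rintro _ ⟨B, hB, rfl⟩
    exact ⟨(fun z => N • z) ⁻¹' B, measurable_nsmul_torus N hB, by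
      ext ω; simp only [Set.mem_preimage, nsmul_proj_succ hN]⟩
  le' n := (measurable_proj N n).comap_le

/-- Each real number is recovered from its class modulo `2πN^n` once `n` is large, because `N ^ n →
∞`. Hence the identity is a pointwise limit of functions measurable for the supremum. -/
theorem iSup_periodicFiltration {N : ℕ} (hN : 2 ≤ N) :
    ⨆ n, periodicFiltration (show 0 < N by omega) n = Real.measurableSpace := by
  have hN0 : 0 < N := by omega
  refine le_antisymm (iSup_le fun n => (periodicFiltration hN0).le n) ?_
  -- The fundamental interval is centred at `0`, so that `ω / N ^ n` eventually lies in it for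
  -- negative `ω` too.
  let s : Torus → ℝ := fun z => AddCircle.measurableEquivIoc (2 * Real.pi) (-Real.pi) z
  have hs : Measurable s := measurable_subtype_coe.comp
    (AddCircle.measurableEquivIoc (2 * Real.pi) (-Real.pi)).measurable
  have hs2 : ∀ ω : ℝ, ω ∈ Set.Ioc (-Real.pi) (-Real.pi + 2 * Real.pi) → s (ω : Torus) = ω :=
    fun ω hω => congrArg Subtype.val
      ((AddCircle.measurableEquivIoc (2 * Real.pi) (-Real.pi)).apply_symm_apply ⟨ω, hω⟩)
  have hid : @Measurable ℝ ℝ (⨆ n, periodicFiltration hN0 n) Real.measurableSpace id := by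
    refine @measurable_of_tendsto_metrizable ℝ ℝ (⨆ n, periodicFiltration hN0 n) _ _ _ _
      (fun n ω => (N : ℝ) ^ n * s (proj N n ω)) id (fun n => ?_) ?_
    · refine Measurable.const_mul ?_ _
      refine hs.comp ?_
      exact Measurable.mono (comap_measurable (proj N n))
        (le_iSup (fun n => periodicFiltration hN0 n) n) le_rfl
    · rw [tendsto_pi_nhds]
      intro ω
      have ht : Tendsto (fun n : ℕ => (N : ℝ) ^ n) atTop atTop :=
        tendsto_pow_atTop_atTop_of_one_lt (by exact_mod_cast hN)
      refine tendsto_const_nhds.congr' ?_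
      filter_upwards [ht.eventually_gt_atTop (|ω| / Real.pi)] with n hn
      have hp : (0 : ℝ) < (N : ℝ) ^ n := by positivity
      rw [div_lt_iff₀ Real.pi_pos] at hn
      have h1 := abs_lt.1 hn
      rw [proj, hs2]
      · field_simp; rfl
      · constructor
        · rw [lt_div_iff₀ hp]; linarith
        · rw [div_le_iff₀ hp]; linarith
  intro t ht
  exact hid ht

/-- The periodic sets of all levels form a π-system generating the Borel sets, so Dynkin's argument
applies. -/
theorem ae_eq_zero_of_periodic_setIntegral {E : Type*} [NormedAddCommGroup E] [NormedSpace ℝ E]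
    [CompleteSpace E] {N : ℕ} (hN : 2 ≤ N) {G : ℝ → E} (hG : Integrable G)
    (h : ∀ (n : ℕ) (B : Set Torus), MeasurableSet B → ∫ ω in proj N n ⁻¹' B, G ω = 0) :
    ∀ᵐ ω : ℝ, G ω = 0 := by
  have hN0 : 0 < N := by omega
  have hgen : Real.measurableSpace = MeasurableSpace.generateFrom
      (⋃ n, {t | MeasurableSet[periodicFiltration hN0 n] t}) := by
    exact (iSup_periodicFiltration hN).symm.trans
      (MeasurableSpace.generateFrom_iUnion_measurableSet fun n => periodicFiltration hN0 n).symm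
  have hpi := isPiSystem_iUnion_of_monotone
    (fun n => {t | MeasurableSet[periodicFiltration hN0 n] t})
    (fun n => @MeasurableSpace.isPiSystem_measurableSet _ (periodicFiltration hN0 n))
    (fun i j hij => (periodicFiltration hN0).mono hij)
  have key : ∀ s : Set ℝ, MeasurableSet s → ∫ ω in s, G ω = 0 := by
    intro s hs
    induction s, hs using MeasurableSpace.induction_on_inter hgen hpi with
    | empty => simp
    | basic t ht =>
      obtain ⟨n, B, hB, rfl⟩ := Set.mem_iUnion.1 ht
      exact h n B hB
    | compl t ht ih =>
      -- Complements need the total integral to vanish: the case of the full circle.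
      have h0 := h 0 Set.univ MeasurableSet.univ
      rw [Set.preimage_univ, setIntegral_univ] at h0
      have := integral_add_compl ht hG
      rwa [ih, zero_add, h0] at this
    | iUnion f hd hm ih =>
      rw [integral_iUnion hm hd hG.integrableOn]
      simp [ih]
  exact hG.ae_eq_zero_of_forall_setIntegral_eq_zero fun s hs _ => key s hs

/-! ### Densities of the images of a function under `proj` -/

section Dilation

variable {𝕜 : Type*} [RCLike 𝕜]

/-- The dilation `N^n F(N^n ω)`. -/
def dil (N n : ℕ) (F : ℝ → 𝕜) (ω : ℝ) : 𝕜 := (N : 𝕜) ^ n * F ((N : ℝ) ^ n * ω)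

theorem integrable_dil {N : ℕ} (hN : 0 < N) (n : ℕ) {F : ℝ → 𝕜} (hF : Integrable F) :
    Integrable (dil N n F) :=
  (hF.comp_mul_left' (pow_ne_zero n (by exact_mod_cast hN.ne'))).const_mul _

theorem integral_proj_mul {N : ℕ} (hN : 0 < N) (n : ℕ) {F : ℝ → 𝕜} (hF : Integrable F)
    {g : Torus → 𝕜} (hg : AEStronglyMeasurable g volume) {C : ℝ} (hC : ∀ᵐ z, ‖g z‖ ≤ C) :
    ∫ ω : ℝ, g (proj N n ω) * F ω = ∫ z : Torus, g z * per (dil N n F) z := by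
  have hp : (0 : ℝ) < (N : ℝ) ^ n := by positivity
  rw [← integral_coe_mul (integrable_dil hN n hF) hg hC]
  have h := Measure.integral_comp_mul_left (fun ω : ℝ => g (proj N n ω) * F ω) ((N : ℝ) ^ n)
  rw [abs_of_pos (by positivity)] at h
  have h2 : ∀ ω : ℝ, g (ω : Torus) * dil N n F ω =
      ((N : ℝ) ^ n) • (g (proj N n ((N : ℝ) ^ n * ω)) * F ((N : ℝ) ^ n * ω)) := by
    intro ω
    rw [proj, mul_div_cancel_left₀ _ hp.ne', dil, RCLike.real_smul_eq_coe_mul]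
    push_cast
    ring
  simp_rw [h2]
  rw [integral_smul, h, smul_smul, mul_inv_cancel₀ hp.ne', one_smul]

theorem setIntegral_proj {N : ℕ} (hN : 0 < N) (n : ℕ) {F : ℝ → 𝕜} (hF : Integrable F)
    {B : Set Torus} (hB : MeasurableSet B) :
    ∫ ω in proj N n ⁻¹' B, F ω = ∫ z in B, per (dil N n F) z := by
  have h := integral_proj_mul (𝕜 := 𝕜) hN n hF (g := B.indicator fun _ => 1)
    ((stronglyMeasurable_const.indicator hB).aestronglyMeasurable) (C := 1)
    (Eventually.of_forall fun z => by
      by_cases hz : z ∈ B <;> simp [hz])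
  rw [← integral_indicator hB, ← integral_indicator (measurable_proj N n hB)]
  refine Eq.trans ?_ (h.trans ?_)
  · refine integral_congr_ae (Eventually.of_forall fun ω => ?_)
    by_cases hz : proj N n ω ∈ B <;> simp [hz]
  · refine integral_congr_ae (Eventually.of_forall fun z => ?_)
    by_cases hz : z ∈ B <;> simp [hz]

theorem ae_eq_of_per_dil {N : ℕ} (hN : 2 ≤ N) {F G : ℝ → 𝕜} (hF : Integrable F)
    (hG : Integrable G) (h : ∀ n, ∀ᵐ z : Torus, per (dil N n F) z = per (dil N n G) z) :
    ∀ᵐ ω : ℝ, F ω = G ω := by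
  have hN0 : 0 < N := by omega
  have := ae_eq_zero_of_periodic_setIntegral hN (hF.sub hG) fun n B hB => by
    have e := integral_sub (μ := volume.restrict (proj N n ⁻¹' B)) hF.integrableOn hG.integrableOn
    simp only [Pi.sub_apply]
    rw [e, setIntegral_proj hN0 n hF hB, setIntegral_proj hN0 n hG hB,
      integral_congr_ae (ae_restrict_of_ae (h n)), sub_self]
  filter_upwards [this] with ω hω
  exact sub_eq_zero.1 hω

theorem setIntegral_per_dil_succ {N : ℕ} (hN : 0 < N) (n : ℕ) {F : ℝ → 𝕜} (hF : Integrable F)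
    {B : Set Torus} (hB : MeasurableSet B) :
    ∫ z in B, per (dil N n F) z = ∫ z in (fun z => N • z) ⁻¹' B, per (dil N (n + 1) F) z := by
  rw [← setIntegral_proj hN n hF hB,
    ← setIntegral_proj hN (n + 1) hF (measurable_nsmul_torus N hB)]
  congr 2
  ext ω
  simp only [Set.mem_preimage, nsmul_proj_succ hN]

end Dilation

/-- A consistent family of functions `k n` on the circle dominated by the periodizations of `q`
comes from a function `q X` on the line, and `X` is a limit of quotients. -/
theorem exists_density_of_consistent {N : ℕ} (hN : 0 < N) {q : ℝ → ℝ} (hqm : Measurable q)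
    (hq : Integrable q) (hq0 : ∀ ω, 0 ≤ q ω) {k : ℕ → Torus → ℝ} (hk : ∀ n, Integrable (k n) volume)
    {C : ℝ} (hC : ∀ n, ∀ᵐ z : Torus, |k n z| ≤ C * per (dil N n q) z)
    (hcons : ∀ n, ∀ B : Set Torus, MeasurableSet B →
      ∫ z in B, k n z = ∫ z in (fun z => N • z) ⁻¹' B, k (n + 1) z) :
    ∃ X : ℝ → ℝ, Measurable X ∧ Integrable (fun ω => X ω * q ω) ∧
      (∀ᵐ ω : ℝ, q ω ≠ 0 →
        Tendsto (fun n => k n (proj N n ω) / per (dil N n q) (proj N n ω)) atTop (𝓝 (X ω))) ∧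
      ∀ n, ∀ᵐ z : Torus, per (dil N n fun ω => X ω * q ω) z = k n z := by
  set D : ℕ → Torus → ℝ := fun n => per (dil N n q) with hD
  have hDi : ∀ n, Integrable (D n) volume := fun n => integrable_per (integrable_dil hN n hq)
  have hD0 : ∀ n z, 0 ≤ D n z := by
    intro n z
    obtain ⟨ω, rfl⟩ : ∃ ω : ℝ, (ω : Torus) = z := ⟨_, coe_rep₀ z⟩
    exact tsum_nonneg fun j => mul_nonneg (by positivity) (hq0 _)
  have hra : ∀ n, AEStronglyMeasurable (fun z => k n z / D n z) volume := fun n =>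
    ((hk n).aemeasurable.div (hDi n).aemeasurable).aestronglyMeasurable
  set r : ℕ → Torus → ℝ := fun n => (hra n).mk _ with hr
  have hrm : ∀ n, StronglyMeasurable (r n) := fun n => (hra n).stronglyMeasurable_mk
  have hre : ∀ n, ∀ᵐ z : Torus, r n z = k n z / D n z := fun n => by
    filter_upwards [(hra n).ae_eq_mk] with z hz using hz.symm
  have hrD : ∀ n, ∀ᵐ z : Torus, r n z * D n z = k n z := fun n => by
    filter_upwards [hre n, hC n] with z h1 h2
    rw [h1]
    rcases eq_or_ne (D n z) 0 with h0 | h0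
    · rw [show per (dil N n q) z = 0 from h0, mul_zero] at h2
      rw [abs_nonpos_iff.1 h2, h0, mul_zero]
    · exact div_mul_cancel₀ _ h0
  have hrC : ∀ n, ∀ᵐ z : Torus, ‖r n z‖ ≤ |C| := fun n => by
    filter_upwards [hre n, hC n] with z h1 h2
    rw [h1, Real.norm_eq_abs, abs_div, abs_of_nonneg (hD0 n z)]
    refine div_le_of_le_mul₀ (hD0 n z) (abs_nonneg _) (h2.trans ?_)
    exact mul_le_mul_of_nonneg_right (le_abs_self C) (hD0 n z)
  set Q : Measure ℝ := volume.withDensity fun ω => ENNReal.ofReal (q ω) with hQ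
  have : IsFiniteMeasure Q := isFiniteMeasure_withDensity_ofReal hq.2
  have hQac : Q ≪ volume := withDensity_absolutelyContinuous _ _
  have hQint : ∀ (Y : ℝ → ℝ) (s : Set ℝ), MeasurableSet s →
      ∫ ω in s, Y ω ∂Q = ∫ ω in s, Y ω * q ω := by
    intro Y s hs
    rw [hQ, setIntegral_withDensity_eq_setIntegral_toReal_smul₀
      (hqm.ennreal_ofReal.aemeasurable) (by simp) _ hs]
    refine integral_congr_ae (Eventually.of_forall fun ω => ?_)
    simp only [smul_eq_mul]
    rw [ENNReal.toReal_ofReal (hq0 ω), mul_comm]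
  have hρ : ∀ n, ∀ B : Set Torus, MeasurableSet B →
      ∫ ω in proj N n ⁻¹' B, r n (proj N n ω) ∂Q = ∫ z in B, k n z := by
    intro n B hB
    rw [hQint _ _ (measurable_proj N n hB), ← integral_indicator hB,
      ← integral_indicator (measurable_proj N n hB)]
    have h := integral_proj_mul (𝕜 := ℝ) hN n hq (g := B.indicator (r n))
      (((hrm n).indicator hB).aestronglyMeasurable) (C := |C|) (by
        filter_upwards [hrC n] with z hz
        exact (norm_indicator_le_norm_self _ _).trans hz)
    refine Eq.trans ?_ (h.trans ?_)
    · refine integral_congr_ae (Eventually.of_forall fun ω => ?_)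
      by_cases hz : proj N n ω ∈ B <;> simp [hz]
    · refine integral_congr_ae ?_
      filter_upwards [hrD n] with z hz
      by_cases hzB : z ∈ B
      · simpa [hzB] using hz
      · simp [hzB]
  obtain ⟨X, hXm, hXt, hXs⟩ := exists_tendsto_of_bounded_martingale (μ := Q)
    (ℱ := periodicFiltration hN) (f := fun n ω => r n (proj N n ω)) (C := |C|)
    (fun n => (hrm n).comp_measurable (comap_measurable (proj N n)))
    (fun n => hQac (ae_proj hN n (hrC n)))
    (by
      rintro n _ ⟨B, hB, rfl⟩
      have h1 := hρ (n + 1) _ (measurable_nsmul_torus N hB)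
      rw [hρ n B hB, hcons n B hB, ← h1]
      congr 2
      ext ω
      simp only [Set.mem_preimage, nsmul_proj_succ hN])
  have hXC : ∀ᵐ ω ∂Q, ‖X ω‖ ≤ |C| := by
    have h1 : ∀ᵐ ω ∂Q, ∀ n, ‖r n (proj N n ω)‖ ≤ |C| :=
      ae_all_iff.2 fun n => hQac (ae_proj hN n (hrC n))
    filter_upwards [h1, hXt] with ω h2 h3
    exact le_of_tendsto' h3.norm h2
  have hQae : ∀ {p : ℝ → Prop}, (∀ᵐ ω ∂Q, p ω) → ∀ᵐ ω : ℝ, q ω ≠ 0 → p ω := by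
    intro p hp
    rw [hQ, ae_withDensity_iff hqm.ennreal_ofReal] at hp
    filter_upwards [hp] with ω hω h0
    exact hω (by simpa using lt_of_le_of_ne (hq0 ω) h0.symm)
  have hXq : Integrable fun ω => X ω * q ω := by
    refine (hq.const_mul |C|).mono (hXm.mul hqm).aestronglyMeasurable ?_
    filter_upwards [hQae hXC] with ω hω
    rcases eq_or_ne (q ω) 0 with h0 | h0
    · simp [h0]
    · rw [norm_mul, norm_mul, Real.norm_eq_abs |C|, abs_abs]
      exact mul_le_mul_of_nonneg_right (hω h0) (norm_nonneg _)
  refine ⟨X, hXm, hXq, ?_, fun n => ?_⟩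
  · have h1 : ∀ᵐ ω : ℝ, ∀ n, r n (proj N n ω) = k n (proj N n ω) / D n (proj N n ω) :=
      ae_all_iff.2 fun n => ae_proj hN n (hre n)
    filter_upwards [hQae hXt, h1] with ω h2 h3 h0
    exact (h2 h0).congr h3
  · refine (integrable_per (integrable_dil hN n hXq)).ae_eq_of_forall_setIntegral_eq _ _ (hk n)
      fun B hB _ => ?_
    rw [← setIntegral_proj hN n hXq hB, ← hQint X _ (measurable_proj N n hB),
      hXs n _ ⟨B, hB, rfl⟩, hρ n B hB]

theorem per_add {E : Type*} [NormedAddCommGroup E] [CompleteSpace E] {F G : ℝ → E}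
    (hF : Integrable F) (hG : Integrable G) :
    ∀ᵐ z : Torus, per (fun ω => F ω + G ω) z = per F z + per G z := by
  rw [ae_torus_iff]
  filter_upwards [ae_summable_norm_shift hF, ae_summable_norm_shift hG] with ω h1 h2
  simp only [per_coe]
  exact h1.of_norm.tsum_add h2.of_norm

theorem per_ofReal (F : ℝ → ℝ) (z : Torus) : per (fun ω => (F ω : ℂ)) z = ((per F z : ℝ) : ℂ) := by
  obtain ⟨ω, rfl⟩ : ∃ ω : ℝ, (ω : Torus) = z := ⟨_, coe_rep₀ z⟩
  rw [per_coe, per_coe, Complex.ofReal_tsum]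

theorem per_nonneg {F : ℝ → ℝ} (hF : ∀ ω, 0 ≤ F ω) (z : Torus) : 0 ≤ per F z := by
  obtain ⟨ω, rfl⟩ : ∃ ω : ℝ, (ω : Torus) = z := ⟨_, coe_rep₀ z⟩
  exact tsum_nonneg fun j => hF _

/-- The product `W(z) W(z^N) ⋯ W(z^{N^{n-1}})`. -/
def wprod {𝕜 : Type*} [CommMonoid 𝕜] (N : ℕ) (W : Torus → 𝕜) (n : ℕ) (z : Torus) : 𝕜 :=
  ∏ k ∈ Finset.range n, W (N ^ k • z)

theorem wprod_succ {𝕜 : Type*} [CommMonoid 𝕜] (N : ℕ) (W : Torus → 𝕜) (n : ℕ) (z : Torus) :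
    wprod N W (n + 1) z = wprod N W n z * W (N ^ n • z) :=
  Finset.prod_range_succ _ _

theorem wprod_succ' {𝕜 : Type*} [CommMonoid 𝕜] (N : ℕ) (W : Torus → 𝕜) (n : ℕ) (z : Torus) :
    wprod N W (n + 1) z = wprod N W n (N • z) * W z := by
  rw [wprod, Finset.prod_range_succ', pow_zero, one_smul, wprod]
  congr 1
  refine Finset.prod_congr rfl fun k _ => ?_
  rw [pow_succ, mul_smul]

theorem measurePreserving_nsmul_torus {N : ℕ} (hN : 0 < N) :
    MeasurePreserving (fun z : Torus => N • z) volume volume := by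
  have := Measure.measurePreserving_zsmul (volume : Measure Torus) (n := (N : ℤ)) (by exact_mod_cast hN.ne')
  simpa only [natCast_zsmul] using this

theorem ae_nsmul {N : ℕ} (hN : 0 < N) {p : Torus → Prop} (hp : ∀ᵐ z : Torus, p z) :
    ∀ᵐ z : Torus, p (N • z) :=
  (measurePreserving_nsmul_torus hN).quasiMeasurePreserving.ae hp

theorem aestronglyMeasurable_wprod {N : ℕ} (hN : 0 < N) {W : Torus → ℂ}
    (hW : AEStronglyMeasurable W volume) (n : ℕ) :
    AEStronglyMeasurable (wprod N W n) volume :=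
  Finset.aestronglyMeasurable_fun_prod _ fun k _ => hW.comp_quasiMeasurePreserving
    (measurePreserving_nsmul_torus (pow_pos hN k)).quasiMeasurePreserving

theorem norm_wprod_le {N : ℕ} (hN : 0 < N) {W : Torus → ℂ} {C : ℝ} (hC : ∀ᵐ z : Torus, ‖W z‖ ≤ C)
    (n : ℕ) : ∀ᵐ z : Torus, ‖wprod N W n z‖ ≤ C ^ n := by
  have h : ∀ᵐ z : Torus, ∀ k : ℕ, ‖W (N ^ k • z)‖ ≤ C := ae_all_iff.2 fun k =>
    ae_nsmul (p := fun z => ‖W z‖ ≤ C) (pow_pos hN k) hC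
  filter_upwards [h] with z hz
  rw [wprod, norm_prod]
  exact (Finset.prod_le_prod (fun k _ => norm_nonneg _) fun k _ => hz k).trans_eq (by simp)

theorem per_dil_of_scaling {𝕜 : Type*} [RCLike 𝕜] {N : ℕ} (hN : 0 < N) {v : ℝ → 𝕜} {W : Torus → 𝕜}
    (hs : ∀ᵐ ω : ℝ, (N : 𝕜) * v (N * ω) = W (ω : Torus) * v ω) (n : ℕ) :
    ∀ᵐ z : Torus, per (dil N n v) z = wprod N W n z * per v z := by
  have h : ∀ n, ∀ᵐ ω : ℝ, dil N n v ω = wprod N W n (ω : Torus) * v ω := by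
    intro n
    induction n with
    | zero => exact Eventually.of_forall fun ω => by simp [dil, wprod]
    | succ n ih =>
      filter_upwards [ih, ae_comp_mul (pow_pos hN n) hs] with ω h1 h2
      rw [coe_natCast_mul, Nat.cast_pow, ← mul_assoc (N : ℝ), ← pow_succ'] at h2
      rw [dil] at h1
      rw [wprod_succ, dil]
      linear_combination (N : 𝕜) ^ n * h2 + W (N ^ n • (ω : Torus)) * h1
  filter_upwards [per_congr (h n)] with z hz
  rw [hz, per_mul]

theorem nsmul_add_torsion {N : ℕ} (hN : 0 < N) (z : Torus) (j : Fin N) :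
    N • (z + torsion N j) = N • z := by
  rw [smul_add, torsion, ← AddCircle.coe_nsmul]
  have : N • ((j : ℕ) • (2 * Real.pi / N) : ℝ) = (j : ℕ) • (2 * Real.pi) := by
    have hN' : (N : ℝ) ≠ 0 := by exact_mod_cast hN.ne'
    simp only [nsmul_eq_mul]
    field_simp
  rw [this, AddCircle.coe_nsmul, AddCircle.coe_period, smul_zero, add_zero]

theorem mul_integral_nsmul {N : ℕ} (hN : 0 < N) {G g : Torus → ℂ}
    (hint : Integrable (fun z : Torus => g (N • z) * G z) volume) :
    (N : ℂ) * ∫ z : Torus, g (N • z) * G z =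
      ∫ z : Torus, g (N • z) * ∑ j : Fin N, G (z + torsion N j) := by
  have h1 : ∀ j : Fin N, ∫ z : Torus, g (N • z) * G z =
      ∫ z : Torus, g (N • z) * G (z + torsion N j) := fun j => by
    rw [← integral_add_right_eq_self (fun z : Torus => g (N • z) * G z) (torsion N j)]
    simp_rw [nsmul_add_torsion hN]
  have hint' : ∀ j : Fin N, Integrable (fun z : Torus => g (N • z) * G (z + torsion N j)) volume :=
    fun j => by
      have := hint.comp_add_right (torsion N j)
      simpa only [nsmul_add_torsion hN] using this
  simp_rw [Finset.mul_sum]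
  rw [integral_finsetSum _ fun j _ => hint' j, ← Finset.sum_congr rfl fun j _ => h1 j]
  simp

theorem integral_comp_nsmul {N : ℕ} (hN : 0 < N) {g : Torus → ℂ}
    (hg : AEStronglyMeasurable g volume) : ∫ z : Torus, g (N • z) = ∫ z : Torus, g z := by
  have hmp := measurePreserving_nsmul_torus hN
  have hm : AEStronglyMeasurable g (Measure.map (fun z : Torus => N • z) volume) := by
    rwa [hmp.map_eq]
  rw [← integral_map hmp.measurable.aemeasurable hm, hmp.map_eq]

/-- The transfer operator is adjoint to composition with `z ↦ z ^ N`. -/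
theorem integral_nsmul_mul_of_transfer {N : ℕ} (hN : 0 < N) {m m' h₀ : Torus → ℂ}
    (hG : Integrable (fun z => conj (m z) * m' z * h₀ z) volume)
    (hh : Integrable h₀ volume) (ht : ∀ᵐ z : Torus, transfer N m m' h₀ z = h₀ z)
    {g : Torus → ℂ} (hg : AEStronglyMeasurable g volume) {C : ℝ} (hC : ∀ᵐ z, ‖g z‖ ≤ C) :
    ∫ z : Torus, g (N • z) * (conj (m z) * m' z * h₀ z) = ∫ z : Torus, g z * h₀ z := by
  have hmp := measurePreserving_nsmul_torus hN
  have hint : Integrable (fun z => g (N • z) * (conj (m z) * m' z * h₀ z)) volume :=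
    hG.bdd_mul (hg.comp_measurePreserving hmp) (ae_nsmul (p := fun z => ‖g z‖ ≤ C) hN hC)
  have hN' : (N : ℂ) ≠ 0 := by exact_mod_cast hN.ne'
  have h3 : ∀ᵐ z : Torus, g (N • z) * ∑ j : Fin N, conj (m (z + torsion N j)) *
      m' (z + torsion N j) * h₀ (z + torsion N j) = (N : ℂ) * (g (N • z) * h₀ (N • z)) := by
    filter_upwards [ae_nsmul (p := fun z => transfer N m m' h₀ z = h₀ z) hN ht] with z hz
    rw [transfer_nsmul hN] at hz
    rw [← hz, one_div]
    generalize ∑ j : Fin N, conj (m (z + torsion N j)) *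
      m' (z + torsion N j) * h₀ (z + torsion N j) = S
    rw [mul_left_comm (N : ℂ), mul_inv_cancel_left₀ hN']
  have h2 := mul_integral_nsmul hN hint
  rw [integral_congr_ae h3, integral_const_mul,
    integral_comp_nsmul hN (g := fun z => g z * h₀ z) (hg.mul hh.1)] at h2
  exact mul_left_cancel₀ hN' h2

section Filters

variable {N : ℕ} {m₀ m₀' : LinfT} {h₀ : Torus → ℂ}

theorem norm_filter_mul_le (m₀ m₀' : LinfT) :
    ∀ᵐ z : Torus, ‖conj (m₀ z) * m₀' z‖ ≤ ‖m₀‖ * ‖m₀'‖ := by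
  rw [← ae_haar_iff]
  filter_upwards [ae_norm_le_norm_linf m₀, ae_norm_le_norm_linf m₀'] with z h1 h2
  rw [norm_mul, RCLike.norm_conj]
  exact mul_le_mul h1 h2 (norm_nonneg _) (norm_nonneg _)

theorem stronglyMeasurable_filter_mul (m₀ m₀' : LinfT) :
    StronglyMeasurable fun z : Torus => conj (m₀ z) * m₀' z :=
  (Complex.continuous_conj.comp_stronglyMeasurable (Lp.stronglyMeasurable m₀)).mul
    (Lp.stronglyMeasurable m₀')

theorem integrable_wprod_mul (hN : 0 < N) (hh : Integrable h₀ volume) (n : ℕ) :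
    Integrable (fun z => wprod N (fun z => conj (m₀ z) * m₀' z) n z * h₀ z) volume :=
  hh.bdd_mul (aestronglyMeasurable_wprod hN
    (stronglyMeasurable_filter_mul m₀ m₀').aestronglyMeasurable n)
    (norm_wprod_le hN (norm_filter_mul_le m₀ m₀') n)

theorem setIntegral_wprod_succ (hN : 0 < N) (hh : Integrable h₀ volume)
    (ht : ∀ᵐ z : Torus, transfer N m₀ m₀' h₀ z = h₀ z) (n : ℕ) {B : Set Torus}
    (hB : MeasurableSet B) :
    ∫ z in B, wprod N (fun z => conj (m₀ z) * m₀' z) n z * h₀ z =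
      ∫ z in (fun z => N • z) ⁻¹' B, wprod N (fun z => conj (m₀ z) * m₀' z) (n + 1) z * h₀ z := by
  set W : Torus → ℂ := fun z => conj (m₀ z) * m₀' z with hW
  have hWm : AEStronglyMeasurable W volume :=
    (stronglyMeasurable_filter_mul m₀ m₀').aestronglyMeasurable
  have hG : Integrable (fun z => conj (m₀ z) * m₀' z * h₀ z) volume :=
    hh.bdd_mul hWm (norm_filter_mul_le m₀ m₀')
  have h := integral_nsmul_mul_of_transfer hN hG hh ht (g := B.indicator (wprod N W n))
    ((aestronglyMeasurable_wprod hN hWm n).indicator hB) (C := (‖m₀‖ * ‖m₀'‖) ^ n) (by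
      filter_upwards [norm_wprod_le hN (norm_filter_mul_le m₀ m₀') n] with z hz
      exact (norm_indicator_le_norm_self _ _).trans hz)
  rw [← integral_indicator hB, ← integral_indicator (measurable_nsmul_torus N hB)]
  refine Eq.trans ?_ (h.symm.trans ?_)
  · refine integral_congr_ae (Eventually.of_forall fun z => ?_)
    by_cases hz : z ∈ B <;> simp [hz]
  · refine integral_congr_ae (Eventually.of_forall fun z => ?_)
    by_cases hz : N • z ∈ B
    · simp only [hz, Set.indicator_of_mem, Set.mem_preimage, wprod_succ', hW]
      ring
    · simp [hz]

end Filters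

theorem norm_sq_hat_scaling {N : ℕ} (hN : 0 < N) {φ : L2R} {m₀ : LinfT}
    (hφ : IsWaveletRep N φ m₀) :
    ∀ᵐ ω : ℝ, (N : ℝ) * ‖hat φ (N * ω)‖ ^ 2 = ‖m₀ (ω : Torus)‖ ^ 2 * ‖hat φ ω‖ ^ 2 := by
  filter_upwards [hφ.scaling hN] with ω h
  have h2 := congrArg (fun x : ℂ => ‖x‖ ^ 2) h
  simp only [norm_mul, mul_pow, Complex.norm_real, Real.norm_eq_abs, sq_abs] at h2
  rwa [Real.sq_sqrt (Nat.cast_nonneg N)] at h2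

/-- A fixed point of the transfer operator is the periodization of a function on the line, compatibly
with all dilations. -/
theorem exists_line_density {N : ℕ} (hN : 2 ≤ N) {φ φ' : L2R} {m₀ m₀' : LinfT}
    (hφ : IsWaveletRep N φ m₀) (hφ' : IsWaveletRep N φ' m₀') {h₀ : Torus → ℂ}
    (hh : Integrable h₀ volume) (ht : ∀ᵐ z : Torus, transfer N m₀ m₀' h₀ z = h₀ z) {c : ℝ}
    (hc0 : 0 ≤ c) (hc : ∀ᵐ z : Torus, ‖h₀ z‖ ^ 2 ≤
      c * per (fun ω => ‖hat φ ω‖ ^ 2) z * per (fun ω => ‖hat φ' ω‖ ^ 2) z) :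
    ∃ F : ℝ → ℂ, Measurable F ∧ Integrable F ∧
      (∀ᵐ ω : ℝ, ‖F ω‖ ^ 2 ≤ c * (‖hat φ ω‖ ^ 2 * ‖hat φ' ω‖ ^ 2)) ∧
      ∀ n, ∀ᵐ z : Torus, per (dil N n F) z =
        wprod N (fun z => conj (m₀ z) * m₀' z) n z * h₀ z := by
  have hN0 : 0 < N := by omega
  set P : ℝ → ℝ := fun ω => ‖hat φ ω‖ ^ 2 with hP
  set P' : ℝ → ℝ := fun ω => ‖hat φ' ω‖ ^ 2 with hP'
  have hPi : Integrable P := integrable_norm_sq_hat φ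
  have hPi' : Integrable P' := integrable_norm_sq_hat φ'
  have hP0 : ∀ ω, 0 ≤ P ω := fun ω => sq_nonneg _
  have hP0' : ∀ ω, 0 ≤ P' ω := fun ω => sq_nonneg _
  set q : ℝ → ℝ := fun ω => P ω + P' ω with hqdef
  have hqi : Integrable q := hPi.add hPi'
  have hqm : Measurable q :=
    ((stronglyMeasurable_hat φ).norm.measurable.pow_const 2).add
      ((stronglyMeasurable_hat φ').norm.measurable.pow_const 2)
  have hq0 : ∀ ω, 0 ≤ q ω := fun ω => add_nonneg (hP0 ω) (hP0' ω)
  have hD : ∀ n, ∀ᵐ z : Torus, per (dil N n q) z = per (dil N n P) z + per (dil N n P') z := by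
    intro n
    filter_upwards [per_add (integrable_dil hN0 n hPi) (integrable_dil hN0 n hPi')] with z hz
    rw [← hz]
    congr 1
    funext ω
    simp only [dil, hqdef]
    ring
  have hk0 : ∀ n z, 0 ≤ per (dil N n P) z := fun n =>
    per_nonneg fun ω => mul_nonneg (by positivity) (hP0 _)
  have hk0' : ∀ n z, 0 ≤ per (dil N n P') z := fun n =>
    per_nonneg fun ω => mul_nonneg (by positivity) (hP0' _)
  set k : ℕ → Torus → ℂ := fun n z => wprod N (fun z => conj (m₀ z) * m₀' z) n z * h₀ z with hk
  have hki : ∀ n, Integrable (k n) volume := fun n => integrable_wprod_mul hN0 hh n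
  have hkle : ∀ n, ∀ᵐ z : Torus,
      ‖k n z‖ ^ 2 ≤ c * (per (dil N n P) z * per (dil N n P') z) := by
    intro n
    filter_upwards [hc, per_dil_of_scaling (v := P) (W := fun z => ‖m₀ z‖ ^ 2) hN0 (norm_sq_hat_scaling hN0 hφ) n,
      per_dil_of_scaling (v := P') (W := fun z => ‖m₀' z‖ ^ 2) hN0 (norm_sq_hat_scaling hN0 hφ') n] with z h1 h2 h3
    rw [h2, h3]
    simp only [hk, norm_mul, mul_pow]
    have hw : ‖wprod N (fun z => conj (m₀ z) * m₀' z) n z‖ ^ 2 =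
        wprod N (fun z => ‖m₀ z‖ ^ 2) n z * wprod N (fun z => ‖m₀' z‖ ^ 2) n z := by
      simp only [wprod, norm_prod, ← Finset.prod_pow, ← Finset.prod_mul_distrib, norm_mul,
        RCLike.norm_conj, mul_pow]
    have hw0 : 0 ≤ wprod N (fun z => ‖m₀ z‖ ^ 2) n z * wprod N (fun z => ‖m₀' z‖ ^ 2) n z := by
      rw [← hw]; positivity
    rw [hw]
    refine (mul_le_mul_of_nonneg_left h1 hw0).trans_eq ?_
    ring
  have hkD : ∀ n, ∀ᵐ z : Torus, ‖k n z‖ ≤ Real.sqrt c * per (dil N n q) z := by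
    intro n
    filter_upwards [hkle n, hD n] with z h1 h2
    have hDn : 0 ≤ per (dil N n q) z := h2 ▸ add_nonneg (hk0 n z) (hk0' n z)
    refine (abs_le_of_sq_le_sq' ?_ (by positivity)).2
    rw [mul_pow, Real.sq_sqrt hc0]
    refine h1.trans (mul_le_mul_of_nonneg_left ?_ hc0)
    rw [h2]
    nlinarith [hk0 n z, hk0' n z, mul_nonneg (hk0 n z) (hk0' n z)]
  have hcons : ∀ n, ∀ B : Set Torus, MeasurableSet B →
      ∫ z in B, k n z = ∫ z in (fun z => N • z) ⁻¹' B, k (n + 1) z :=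
    fun n B hB => setIntegral_wprod_succ hN0 hh ht n hB
  have hre : ∀ n (B : Set Torus), ∫ z in B, (k n z).re = (∫ z in B, k n z).re := fun n B =>
    integral_re (𝕜 := ℂ) (hki n).integrableOn
  have him : ∀ n (B : Set Torus), ∫ z in B, (k n z).im = (∫ z in B, k n z).im := fun n B =>
    integral_im (𝕜 := ℂ) (hki n).integrableOn
  obtain ⟨X, hXm, hXi, hXt, hXp⟩ := exists_density_of_consistent hN0 hqm hqi hq0
    (k := fun n => per (dil N n P)) (fun n => integrable_per (integrable_dil hN0 n hPi)) (C := 1)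
    (fun n => by
      filter_upwards [hD n] with z h1
      rw [abs_of_nonneg (hk0 n z), h1]
      linarith [hk0' n z])
    (fun n B hB => setIntegral_per_dil_succ hN0 n hPi hB)
  obtain ⟨X', hXm', hXi', hXt', hXp'⟩ := exists_density_of_consistent hN0 hqm hqi hq0
    (k := fun n => per (dil N n P')) (fun n => integrable_per (integrable_dil hN0 n hPi')) (C := 1)
    (fun n => by
      filter_upwards [hD n] with z h1
      rw [abs_of_nonneg (hk0' n z), h1]
      linarith [hk0 n z])
    (fun n B hB => setIntegral_per_dil_succ hN0 n hPi' hB)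
  obtain ⟨Y, hYm, hYi, hYt, hYp⟩ := exists_density_of_consistent hN0 hqm hqi hq0
    (k := fun n z => (k n z).re) (fun n => (hki n).re) (C := Real.sqrt c)
    (fun n => by
      filter_upwards [hkD n] with z h1
      exact (Complex.abs_re_le_norm _).trans h1)
    (fun n B hB => by rw [hre, hre, hcons n B hB])
  obtain ⟨Z, hZm, hZi, hZt, hZp⟩ := exists_density_of_consistent hN0 hqm hqi hq0
    (k := fun n z => (k n z).im) (fun n => (hki n).im) (C := Real.sqrt c)
    (fun n => by
      filter_upwards [hkD n] with z h1
      exact (Complex.abs_im_le_norm _).trans h1)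
    (fun n B hB => by rw [him, him, hcons n B hB])
  have hXP := ae_eq_of_per_dil hN hXi hPi hXp
  have hXP' := ae_eq_of_per_dil hN hXi' hPi' hXp'
  refine ⟨fun ω => ((Y ω * q ω : ℝ) : ℂ) + Complex.I * ((Z ω * q ω : ℝ) : ℂ), ?_, ?_, ?_, ?_⟩
  · exact (Complex.measurable_ofReal.comp (hYm.mul hqm)).add
      ((Complex.measurable_ofReal.comp (hZm.mul hqm)).const_mul _)
  · exact hYi.ofReal.add (hZi.ofReal.const_mul _)
  · have hall : ∀ᵐ ω : ℝ, ∀ n, ‖k n (proj N n ω)‖ ^ 2 ≤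
        c * (per (dil N n P) (proj N n ω) * per (dil N n P') (proj N n ω)) :=
      ae_all_iff.2 fun n => ae_proj hN0 n (hkle n)
    filter_upwards [hall, hXt, hXt', hYt, hZt, hXP, hXP'] with ω h1 h2 h3 h4 h5 h6 h7
    have hn : ‖((Y ω * q ω : ℝ) : ℂ) + Complex.I * ((Z ω * q ω : ℝ) : ℂ)‖ ^ 2 =
        (Y ω ^ 2 + Z ω ^ 2) * q ω ^ 2 := by
      rw [← Complex.normSq_eq_norm_sq, Complex.normSq_apply]
      simp
      ring
    rw [hn]
    rcases eq_or_ne (q ω) 0 with h0 | h0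
    · rw [h0]
      have := mul_nonneg hc0 (mul_nonneg (hP0 ω) (hP0' ω))
      simpa using this
    · have hlim : Y ω ^ 2 + Z ω ^ 2 ≤ c * (X ω * X' ω) := by
        refine le_of_tendsto_of_tendsto' (((h4 h0).pow 2).add ((h5 h0).pow 2))
          (((h2 h0).mul (h3 h0)).const_mul c) fun n => ?_
        have e := h1 n
        rw [← Complex.normSq_eq_norm_sq, Complex.normSq_apply] at e
        rw [div_pow, div_pow, ← add_div, div_mul_div_comm, mul_div_assoc', ← pow_two]
        refine div_le_div_of_nonneg_right ?_ (sq_nonneg _)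
        nlinarith [e]
      have e1 : X ω * q ω = P ω := h6
      have e2 : X' ω * q ω = P' ω := h7
      calc (Y ω ^ 2 + Z ω ^ 2) * q ω ^ 2 ≤ c * (X ω * X' ω) * q ω ^ 2 :=
            mul_le_mul_of_nonneg_right hlim (sq_nonneg _)
        _ = c * ((X ω * q ω) * (X' ω * q ω)) := by ring
        _ = c * (P ω * P' ω) := by rw [e1, e2]
  · intro n
    have hY : Integrable (fun ω => ((dil N n (fun ω => Y ω * q ω) ω : ℝ) : ℂ)) :=
      (integrable_dil hN0 n hYi).ofReal
    have hZ : Integrable (fun ω => Complex.I * ((dil N n (fun ω => Z ω * q ω) ω : ℝ) : ℂ)) :=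
      (integrable_dil hN0 n hZi).ofReal.const_mul _
    filter_upwards [hYp n, hZp n, per_add hY hZ] with z h1 h2 h3
    have e : dil N n (fun ω => ((Y ω * q ω : ℝ) : ℂ) + Complex.I * ((Z ω * q ω : ℝ) : ℂ)) =
        fun ω => ((dil N n (fun ω => Y ω * q ω) ω : ℝ) : ℂ) +
          Complex.I * ((dil N n (fun ω => Z ω * q ω) ω : ℝ) : ℂ) := by
      funext ω
      simp only [dil]
      push_cast
      ring
    rw [e, h3, per_ofReal, per_mul (fun _ => Complex.I), per_ofReal, h1, h2, mul_comm Complex.I]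
    exact Complex.re_add_im _

theorem line_density_scaling {N : ℕ} (hN : 2 ≤ N) {m₀ m₀' : LinfT} {h₀ : Torus → ℂ} {F : ℝ → ℂ}
    (hF : Integrable F)
    (hp : ∀ n, ∀ᵐ z : Torus, per (dil N n F) z =
      wprod N (fun z => conj (m₀ z) * m₀' z) n z * h₀ z) :
    ∀ᵐ ω : ℝ, (N : ℂ) * F (N * ω) = conj (m₀ (ω : Torus)) * m₀' (ω : Torus) * F ω := by
  have hN0 : 0 < N := by omega
  have h1 : Integrable fun ω : ℝ => (N : ℂ) * F (N * ω) :=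
    (hF.comp_mul_left' (by exact_mod_cast hN0.ne')).const_mul _
  have h2 : Integrable fun ω : ℝ => conj (m₀ (ω : Torus)) * m₀' (ω : Torus) * F ω :=
    hF.bdd_mul ((stronglyMeasurable_filter_mul m₀ m₀').comp_measurable
      AddCircle.measurable_mk').aestronglyMeasurable
      (ae_of_ae_torus (norm_filter_mul_le m₀ m₀'))
  refine ae_eq_of_per_dil hN h1 h2 fun n => ?_
  filter_upwards [hp n, hp (n + 1)] with z e1 e2
  have e3 : dil N n (fun ω : ℝ => (N : ℂ) * F (N * ω)) = dil N (n + 1) F := by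
    funext ω
    simp only [dil]
    rw [pow_succ, pow_succ', mul_assoc, mul_assoc]
  have e4 : dil N n (fun ω : ℝ => conj (m₀ (ω : Torus)) * m₀' (ω : Torus) * F ω) =
      fun ω : ℝ => (fun z : Torus => conj (m₀ (N ^ n • z)) * m₀' (N ^ n • z)) (ω : Torus) *
        dil N n F ω := by
    funext ω
    simp only [dil]
    rw [← coe_natCast_mul, Nat.cast_pow]
    ring
  rw [e3, e4, e2, per_mul (fun z : Torus => conj (m₀ (N ^ n • z)) * m₀' (N ^ n • z)), e1, wprod_succ]
  ring

/-- If `r` is dilation invariant on the set `v(Nω) ≠ 0` and vanishes where `v` does, and if the zero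
set of `v` is stable under `ω ↦ Nω`, then `r` agrees where `v ≠ 0` with a dilation invariant
function. -/
theorem exists_dilation_invariant {N : ℕ} (hN : 0 < N) {r v : ℝ → ℂ} (hr : Measurable r) {C : ℝ}
    (hC : ∀ᵐ ω : ℝ, ‖r ω‖ ≤ C) (hr0 : ∀ ω, v ω = 0 → r ω = 0)
    (hv : ∀ᵐ ω : ℝ, v (N * ω) ≠ 0 → v ω ≠ 0 ∧ r (N * ω) = r ω) :
    ∃ f : LinfR, (∀ᵐ x : ℝ, f (N * x) = f x) ∧ ∀ᵐ ω : ℝ, f ω * v ω = r ω * v ω := by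
  have hN' : (0 : ℝ) < N := by exact_mod_cast hN
  have hdiv : ∀ {p : ℝ → Prop}, (∀ᵐ ω : ℝ, p ω) → ∀ᵐ ω : ℝ, ∀ n : ℕ, p (ω / (N : ℝ) ^ n) :=
    fun hp => ae_all_iff.2 fun n => by
      have := ae_comp_div (pow_pos hN n) hp
      simpa only [Nat.cast_pow] using this
  have hstep : ∀ᵐ ω : ℝ, ∀ n : ℕ, v (ω / (N : ℝ) ^ n) ≠ 0 →
      v (ω / (N : ℝ) ^ (n + 1)) ≠ 0 ∧ r (ω / (N : ℝ) ^ n) = r (ω / (N : ℝ) ^ (n + 1)) := by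
    have h := hdiv (ae_comp_div hN hv)
    filter_upwards [h] with ω hω n
    have h1 := hω n
    rwa [mul_div_cancel₀ _ hN'.ne', div_div, ← pow_succ] at h1
  have hconst : ∀ᵐ ω : ℝ, ∀ n : ℕ, v (ω / (N : ℝ) ^ n) ≠ 0 →
      Tendsto (fun k : ℕ => r (ω / (N : ℝ) ^ k)) atTop (𝓝 (r (ω / (N : ℝ) ^ n))) := by
    filter_upwards [hstep] with ω hω n hn
    have : ∀ k, n ≤ k → v (ω / (N : ℝ) ^ k) ≠ 0 ∧ r (ω / (N : ℝ) ^ k) = r (ω / (N : ℝ) ^ n) := by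
      intro k hk
      induction k, hk using Nat.le_induction with
      | base => exact ⟨hn, rfl⟩
      | succ k hk ih => exact ⟨(hω k ih.1).1, (hω k ih.1).2.symm.trans ih.2⟩
    refine tendsto_const_nhds.congr' ?_
    filter_upwards [eventually_ge_atTop n] with k hk using (this k hk).2.symm
  have hex : ∀ᵐ ω : ℝ, ∃ l : ℂ, Tendsto (fun k : ℕ => r (ω / (N : ℝ) ^ k)) atTop (𝓝 l) := by
    filter_upwards [hconst] with ω hω
    by_cases h : ∃ n : ℕ, v (ω / (N : ℝ) ^ n) ≠ 0
    · obtain ⟨n, hn⟩ := h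
      exact ⟨_, hω n hn⟩
    · push Not at h
      exact ⟨0, tendsto_const_nhds.congr fun k => (hr0 _ (h k)).symm⟩
  obtain ⟨g, hgm, hg⟩ := measurable_limit_of_tendsto_metrizable_ae
    (f := fun (k : ℕ) (ω : ℝ) => r (ω / (N : ℝ) ^ k)) (L := atTop)
    (fun k => (hr.comp (measurable_id.div_const _)).aemeasurable) hex
  have hgC : ∀ᵐ ω : ℝ, ‖g ω‖ ≤ C := by
    filter_upwards [hg, hdiv hC] with ω h1 h2
    exact le_of_tendsto' h1.norm h2
  have hgL : MemLp g ∞ volume := memLp_top_of_bound hgm.aestronglyMeasurable C hgC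
  have hginv : ∀ᵐ ω : ℝ, g (N * ω) = g ω := by
    filter_upwards [hg, ae_comp_mul hN hg] with ω h1 h2
    refine tendsto_nhds_unique ((tendsto_add_atTop_iff_nat 1).2 h2) (h1.congr fun k => ?_)
    rw [pow_succ', mul_div_mul_left _ _ hN'.ne']
  have hfg := hgL.coeFn_toLp
  refine ⟨hgL.toLp g, ?_, ?_⟩
  · filter_upwards [hfg, ae_comp_mul hN hfg, hginv] with ω h1 h2 h3
    rw [h1, h2, h3]
  · filter_upwards [hfg, hg, hconst] with ω h1 h2 h3
    rw [h1]
    rcases eq_or_ne (v ω) 0 with h0 | h0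
    · rw [h0, mul_zero, mul_zero]
    · have h4 := h3 0 (by simpa using h0)
      rw [pow_zero, div_one] at h4
      rw [tendsto_nhds_unique h2 h4]

theorem exists_eq_per_mul_hat {N : ℕ} (hN : 2 ≤ N) {φ φ' : L2R} {m₀ m₀' : LinfT}
    (hφ : IsWaveletRep N φ m₀) (hφ' : IsWaveletRep N φ' m₀') {h₀ : Torus → ℂ}
    (hh : Integrable h₀ volume) (ht : ∀ᵐ z : Torus, transfer N m₀ m₀' h₀ z = h₀ z) {c : ℝ}
    (hc0 : 0 ≤ c) (hc : ∀ᵐ z : Torus, ‖h₀ z‖ ^ 2 ≤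
      c * per (fun ω => ‖hat φ ω‖ ^ 2) z * per (fun ω => ‖hat φ' ω‖ ^ 2) z) :
    ∃ f : LinfR, (∀ᵐ x : ℝ, f (N * x) = f x) ∧
      ∀ᵐ z : Torus, h₀ z = per (fun ω => f ω * conj (hat φ ω) * hat φ' ω) z := by
  have hN0 : 0 < N := by omega
  have hNc : (N : ℂ) ≠ 0 := by exact_mod_cast hN0.ne'
  obtain ⟨F, hFm, hFi, hFle, hFp⟩ := exists_line_density hN hφ hφ' hh ht hc0 hc
  have hFs := line_density_scaling hN hFi hFp
  set v : ℝ → ℂ := fun ω => conj (hat φ ω) * hat φ' ω with hv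
  have hvm : Measurable v :=
    ((Complex.continuous_conj.comp_stronglyMeasurable (stronglyMeasurable_hat φ)).mul
      (stronglyMeasurable_hat φ')).measurable
  have hvs := hat_mul_scaling hN0 hφ hφ'
  have hFv : ∀ᵐ ω : ℝ, ‖F ω‖ ≤ Real.sqrt c * ‖v ω‖ := by
    filter_upwards [hFle] with ω hω
    refine (abs_le_of_sq_le_sq' ?_ (by positivity)).2
    rw [mul_pow, Real.sq_sqrt hc0]
    simpa only [hv, norm_mul, RCLike.norm_conj, mul_pow] using hω
  have hrv : ∀ᵐ ω : ℝ, F ω / v ω * v ω = F ω := by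
    filter_upwards [hFv] with ω hω
    rcases eq_or_ne (v ω) 0 with h0 | h0
    · rw [h0, norm_zero, mul_zero] at hω
      rw [h0, mul_zero, norm_le_zero_iff.1 hω]
    · exact div_mul_cancel₀ _ h0
  obtain ⟨f, hf1, hf2⟩ := exists_dilation_invariant hN0 (r := fun ω => F ω / v ω) (v := v)
    (hFm.div hvm) (C := Real.sqrt c) (by
      filter_upwards [hFv] with ω hω
      rw [norm_div]
      exact div_le_of_le_mul₀ (norm_nonneg _) (Real.sqrt_nonneg _) hω)
    (fun ω h0 => by rw [h0, div_zero]) (by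
      filter_upwards [hFs, hvs] with ω h1 h2 h0
      have h2' : (N : ℂ) * v (N * ω) = conj (m₀ (ω : Torus)) * m₀' (ω : Torus) * v ω := h2
      have h3 : v ω ≠ 0 := by
        intro h3
        rw [h3, mul_zero] at h2'
        exact (mul_ne_zero hNc h0) h2'
      refine ⟨h3, ?_⟩
      rw [div_eq_div_iff h0 h3]
      refine mul_left_cancel₀ hNc ?_
      linear_combination v ω * h1 - F ω * h2')
  refine ⟨f, hf1, ?_⟩
  have h0 := hFp 0
  have hFf : ∀ᵐ ω : ℝ, dil N 0 F ω = f ω * conj (hat φ ω) * hat φ' ω := by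
    filter_upwards [hf2, hrv] with ω h1 h2
    rw [mul_assoc]
    refine Eq.trans ?_ h1.symm
    rw [h2]
    simp [dil]
  filter_upwards [h0, per_congr hFf] with z h1 h2
  rw [← h2, h1]
  simp [wprod]

end Wavelet

end

theorem corollary8 (N : ℕ) (hN : 2 ≤ N)
    (φ φ' : Wavelet.L2R) (m₀ m₀' : Wavelet.LinfT)
    (hφ : Wavelet.IsWaveletRep N φ m₀) (hφ' : Wavelet.IsWaveletRep N φ' m₀')
    (h h' : Wavelet.Torus → ℝ)
    (hh : h = Wavelet.per fun ω => ‖Wavelet.hat φ ω‖ ^ 2)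
    (hh' : h' = Wavelet.per fun ω => ‖Wavelet.hat φ' ω‖ ^ 2)
    (h₀ : Wavelet.Torus → ℂ) :
    (Integrable h₀ Wavelet.μT ∧
      (∀ᵐ z ∂Wavelet.μT, Wavelet.transfer N m₀ m₀' h₀ z = h₀ z) ∧
      ∃ c : ℝ, 0 < c ∧ ∀ᵐ z ∂Wavelet.μT, ‖h₀ z‖ ^ 2 ≤ c * h z * h' z) ↔
    ∃ f : Wavelet.LinfR, (∀ᵐ x : ℝ, f (N * x) = f x) ∧
      ∀ᵐ z ∂Wavelet.μT, h₀ z =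
        Wavelet.per (fun ω => f ω * conj (Wavelet.hat φ ω) * Wavelet.hat φ' ω) z := by
  subst hh hh'
  simp only [Wavelet.ae_haar_iff, Wavelet.integrable_haar_iff]
  constructor
  · rintro ⟨h1, h2, c, hc0, hc⟩
    exact Wavelet.exists_eq_per_mul_hat hN hφ hφ' h1 h2 hc0.le hc
  · rintro ⟨f, hf, hf2⟩
    obtain ⟨h1, h2, h3⟩ := Wavelet.per_mul_hat_properties (by omega) hφ hφ' f hf hf2
    exact ⟨h1, h2, _, by positivity, h3⟩
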